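/- Let $N\ge 2$. A state of $N$ qubits is a positive semidefinite operator of trace one on $(\mathbb C^2)^{\otimes N}$. A pure state is biseparable if it is a tensor product of two unit vectors for some partition of the qubits into two nonempty parts; a state is biseparable if it is a convex mixture of pure biseparable states (the partitions may differ from term to term). For a function $D$ with values in $[0,\infty]$ on pairs of states put $E^D_2(\varrho)=\inf\{D(\varrho,\varsigma):\varsigma \text{ biseparable}\}$. For a bit string $i$ of length $N$ with leading bit $0$ let $|\beta_i^{\pm}\rangle=\frac1{\sqrt2}\big(\mathbb I^{\otimes N}\pm\sigma_1^{\otimes N}\big)|i\rangle$, where $\sigma_1$ is the bit flip; these $2^N$ vectors form an orthonormal basis. A state $\xi=\sum_{i,\pm}p_i^\pm|\beta_i^\pm\rangle\langle\beta_i^\pm|$ is called GHZ-diagonal; let $p_{\max}=\max_{i,\pm}p_i^\pm$. Call $D$ valid (on $N$ qubits) if $D(\varrho,\varrho)=0$, if $D(\Omega(\varrho),\Omega(\varrho'))\le D(\varrho,\varrho')$ for all states and all completely positive trace preserving maps $\Omega$, and if $D$ is convex in its second argument. In particular, every contractive jointly convex $D$ with $D(\varrho,\varrho)=0$ is valid.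 (a) A GHZ-diagonal state is biseparable if and only if $p_{\max}\le\frac12$. There is a fixed convex mixture of conjugations by tensor products of single-qubit unitaries that maps every $N$-qubit state $\varrho$ to the GHZ-diagonal state $\Gamma(\varrho)$ with eigenvalues $p_i^\pm=\langle\beta_i^\pm|\varrho|\beta_i^\pm\rangle$ (GHZ-diagonalisation). (b) For every valid $D$ there is a function $g_D:(\frac12,1]\to[0,\infty]$ with the following properties. (i) If a GHZ-diagonal state $\xi$ is not biseparable and $|\beta\rangle$ is a GHZ basis vector belonging to its largest eigenvalue, then some GHZ-diagonal state whose eigenvalue at $|\beta\rangle$ is $\frac12$ is biseparable and attains $\inf_{\varsigma}D(\xi,\varsigma)$ over all biseparable $\varsigma$. (ii) For every GHZ-diagonal $\xi$, $E^D_2(\xi)=0$ if $p_{\max}\le\frac12$, and $E^D_2(\xi)=g_D(p_{\max})$ if $p_{\max}>\frac12$. (iii) $g_D$ is nondecreasing. If moreover $D$ vanishes only on pairs of equal states, then $g_D(p)<g_D(p')$ whenever $\frac12<p<p'\le1$ and $g_D(p)<\infty$. (iv) For every $N$-qubit state $\varrho$ and every tensor product $U$ of single-qubit unitaries, $E^D_2(\varrho)\ge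 E^D_2(\Gamma(U\varrho U^\dagger))$; and if $P=\langle\beta|U\varrho U^\dagger|\beta\rangle>\frac12$ for some GHZ basis vector $|\beta\rangle$, then $E^D_2(\varrho)\ge g_D(P)$. If $D$ is given for all numbers of qubits, is valid for each of them, and is contractive also under the completely positive trace preserving maps that change the number of qubits, then $g_D$ can be chosen independent of $N$. (c) For every $N\ge2$, properties (i)–(iv) hold for the following distances $D$ with the following functions $g_D$, each of which is strictly increasing on $[\frac12,1]$ (with $0\log_2 0=0$): - relative entropy $D_{\rm RE}(\varrho,\varsigma)=\operatorname{Tr}[\varrho(\log_2\varrho-\log_2\varsigma)]$ ($+\infty$ unless $\ker\varsigma\subseteq\ker\varrho$): $g=1+p\log_2p+(1-p)\log_2(1-p)$; - trace distance $D_{\rm Tr}(\varrho,\varsigma)=\frac12\operatorname{Tr}|\varrho-\varsigma|$: $g=p-\frac12$; - infidelity $D_{\rm F}(\varrho,\varsigma)=1-\big[\operatorname{Tr}\sqrt{\sqrt\varsigma\varrho\sqrt\varsigma}\big]^2$: $g=\frac12-\sqrt{p(1-p)}$; - squared Bures distance $D_{\rm B}(\varrho,\varsigma)=2\big[1-\operatorname{Tr}\sqrt{\sqrt\varsigma\varrho\sqrt\varsigma}\big]$: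 $g=2-\sqrt2\,(\sqrt{1-p}+\sqrt p)$; - squared Hellinger distance $D_{\rm H}(\varrho,\varsigma)=2\big[1-\operatorname{Tr}(\sqrt\varrho\sqrt\varsigma)\big]$: $g=2-\sqrt2\,(\sqrt{1-p}+\sqrt p)$. -/

import Mathlib

open scoped ENNReal ComplexOrder

noncomputable section

namespace GHZ

/-! ### States and quantum channels -/

/-- Density matrices: positive semidefinite complex matrices of trace one. -/
def IsState {n : Type*} [Fintype n] (ρ : Matrix n n ℂ) : Prop :=
  ρ.PosSemidef ∧ ρ.trace = 1

/-- The map `id_k ⊗ Φ`, acting blockwise on `k × k` block matrices. -/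
def ampliation {m n : Type*} (Φ : Matrix m m ℂ →ₗ[ℂ] Matrix n n ℂ) (k : ℕ)
    (X : Matrix (Fin k × m) (Fin k × m) ℂ) : Matrix (Fin k × n) (Fin k × n) ℂ :=
  Matrix.of fun a b => Φ (Matrix.of fun i j => X (a.1, i) (b.1, j)) a.2 b.2

/-- Quantum channels: completely positive, trace preserving linear maps. -/
structure IsChannel {m n : Type*} [Fintype m] [Fintype n]
    (Φ : Matrix m m ℂ →ₗ[ℂ] Matrix n n ℂ) : Prop where
  completelyPositive : ∀ (k : ℕ) (X : Matrix (Fin k × m) (Fin k × m) ℂ),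
    X.PosSemidef → (ampliation Φ k X).PosSemidef
  tracePreserving : ∀ X : Matrix m m ℂ, (Φ X).trace = X.trace

/-- The rank-one operator `|ψ⟩⟨ψ|`. -/
def proj {n : Type*} (ψ : n → ℂ) : Matrix n n ℂ := Matrix.vecMulVec ψ (star ψ)

/-! ### Qubits -/

/-- Labels of the computational basis of `N` qubits. -/
abbrev Bits (N : ℕ) : Type := Fin N → Fin 2

/-- Operators on `N` qubits, in the computational basis. -/
abbrev QOp (N : ℕ) : Type := Matrix (Bits N) (Bits N) ℂ

/-- The tensor product `U₁ ⊗ ⋯ ⊗ U_N` of single-qubit operators. -/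
def localOp {N : ℕ} (U : Fin N → Matrix (Fin 2) (Fin 2) ℂ) : QOp N :=
  Matrix.of fun x y => ∏ k, U k (x k) (y k)

/-- Conjugation `ρ ↦ U ρ U†` by `U = U₁ ⊗ ⋯ ⊗ U_N`. -/
def localConj {N : ℕ} (U : Fin N → Matrix (Fin 2) (Fin 2) ℂ) (ρ : QOp N) : QOp N :=
  localOp U * ρ * (localOp U).conjTranspose

/-- `ψ = ⨂_{k < M} ψ⁽ᵏ⁾` for some partition of the `N` qubits into `M` nonempty parts, the `k`-th
part being the qubits `i` with `part i = k`, and some unit vectors `ψ⁽ᵏ⁾` of the parts. -/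
def IsPureMSeparable (N M : ℕ) (ψ : Bits N → ℂ) : Prop :=
  ∃ part : Fin N → Fin M, Function.Surjective part ∧
    ∃ φ : (k : Fin M) → ({i : Fin N // part i = k} → Fin 2) → ℂ,
      (∀ k, ∑ y, ‖φ k y‖ ^ 2 = 1) ∧
      ∀ x, ψ x = ∏ k, φ k (fun i => x i.1)

/-- The set of `M`-separable states: convex mixtures of pure `M`-separable states, the partition
being allowed to vary from term to term. For `M = 2` these are the biseparable states. -/
def mSeparable (N M : ℕ) : Set (QOp N) :=
  convexHull ℝ {ρ | ∃ ψ, IsPureMSeparable N M ψ ∧ ρ = proj ψ}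

/-- The geometric measure `E^D_M(ρ) = inf {D(ρ, ς) | ς M-separable}`. -/
def entanglement {N : ℕ} (M : ℕ) (D : QOp N → QOp N → ℝ≥0∞) (ρ : QOp N) : ℝ≥0∞ :=
  ⨅ ς ∈ mSeparable N M, D ρ ς

/-! ### GHZ-diagonal states -/

/-- Labels `(i, ±)` of the GHZ basis; `i` runs through the first half of the binary ordered
computational basis, i.e. the bit strings with leading bit `0`. -/
abbrev Index (N : ℕ) : Type := {i : Bits N // ∀ k : Fin N, (k : ℕ) = 0 → i k = 0} × ℤˣ

/-- The GHZ basis vector `|β_i^±⟩ = (|i⟩ ± σ₁^{⊗N}|i⟩) / √2`, where `σ₁^{⊗N}` flips all bits. -/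
def ghzVec {N : ℕ} (b : Index N) : Bits N → ℂ :=
  ((Real.sqrt 2 : ℝ) : ℂ)⁻¹ •
    (Pi.single b.1.1 1 + ((b.2 : ℤ) : ℂ) • Pi.single (fun k => Fin.rev (b.1.1 k)) 1)

/-- The operator `∑ p_i^± |β_i^±⟩⟨β_i^±|`. -/
def ghzDiag {N : ℕ} (p : Index N → ℝ) : QOp N :=
  ∑ b, (p b : ℂ) • proj (ghzVec b)

/-- The overlap `⟨β_i^±|ρ|β_i^±⟩`. -/
def overlap {N : ℕ} (ρ : QOp N) (b : Index N) : ℝ :=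
  (star (ghzVec b) ⬝ᵥ (ρ.mulVec (ghzVec b))).re

/-! ### Distances; only their values on states matter -/

/-- Contractive convex distances on the states of `N` qubits. Convexity is asked only in the second
argument, which is the case `ρ = ρ'` of joint convexity
`D(qρ + (1-q)ρ', qχ + (1-q)χ') ≤ q D(ρ, χ) + (1-q) D(ρ', χ')`. -/
structure IsContractiveConvex {N : ℕ} (D : QOp N → QOp N → ℝ≥0∞) : Prop where
  self : ∀ ρ, IsState ρ → D ρ ρ = 0
  contractive : ∀ Φ : QOp N →ₗ[ℂ] QOp N, IsChannel Φ →
    ∀ ρ σ, IsState ρ → IsState σ → D (Φ ρ) (Φ σ) ≤ D ρ σ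
  convex : ∀ ρ χ χ' : QOp N, IsState ρ → IsState χ → IsState χ' →
    ∀ q : ℝ, 0 ≤ q → q ≤ 1 →
      D ρ (q • χ + (1 - q) • χ') ≤ ENNReal.ofReal q * D ρ χ + ENNReal.ofReal (1 - q) * D ρ χ'

/-- A distance given for all numbers of qubits at once, contractive also under the channels that
change the number of qubits. -/
structure IsContractiveConvexFamily (D : (N : ℕ) → QOp N → QOp N → ℝ≥0∞) : Prop where
  each : ∀ N, IsContractiveConvex (D N)
  contractive : ∀ (N N' : ℕ) (Φ : QOp N →ₗ[ℂ] QOp N'), IsChannel Φ →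
    ∀ ρ σ, IsState ρ → IsState σ → D N' (Φ ρ) (Φ σ) ≤ D N ρ σ

/-- `D` separates states. -/
def IsFaithful {N : ℕ} (D : QOp N → QOp N → ℝ≥0∞) : Prop :=
  ∀ ρ σ, IsState ρ → IsState σ → D ρ σ = 0 → ρ = σ

section Standard

variable {n : Type*} [Fintype n] [DecidableEq n]

/-! The continuous functional calculus `cfc f A` applies `f` to the eigenvalues of the Hermitian
matrix `A`. All five expressions are nonnegative on states. -/

open Classical in
/-- Relative entropy `Tr[ρ (log₂ ρ - log₂ σ)]`, infinite unless the kernel of `σ` lies in that of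
`ρ`; here `log₂ 0 = 0`, which amounts to `0 log₂ 0 = 0`. -/
def dRE (ρ σ : Matrix n n ℂ) : ℝ≥0∞ :=
  if ∀ v : n → ℂ, σ.mulVec v = 0 → ρ.mulVec v = 0 then
    ENNReal.ofReal (ρ * (cfc (Real.logb 2) ρ - cfc (Real.logb 2) σ)).trace.re
  else ⊤

/-- Trace distance `½ Tr|ρ - σ|`. -/
def dTr (ρ σ : Matrix n n ℂ) : ℝ≥0∞ :=
  ENNReal.ofReal (1 / 2 * (cfc (fun x : ℝ => |x|) (ρ - σ)).trace.re)

/-- `Tr √(√σ ρ √σ)`. -/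
def rootFidelity (ρ σ : Matrix n n ℂ) : ℝ :=
  (cfc Real.sqrt (cfc Real.sqrt σ * ρ * cfc Real.sqrt σ)).trace.re

/-- Infidelity `1 - [Tr √(√σ ρ √σ)]²`. -/
def dF (ρ σ : Matrix n n ℂ) : ℝ≥0∞ := ENNReal.ofReal (1 - rootFidelity ρ σ ^ 2)

/-- Squared Bures distance `2 [1 - Tr √(√σ ρ √σ)]`. -/
def dB (ρ σ : Matrix n n ℂ) : ℝ≥0∞ := ENNReal.ofReal (2 * (1 - rootFidelity ρ σ))

/-- Squared Hellinger distance `2 [1 - Tr(√ρ √σ)]`. -/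
def dH (ρ σ : Matrix n n ℂ) : ℝ≥0∞ :=
  ENNReal.ofReal (2 * (1 - (cfc Real.sqrt ρ * cfc Real.sqrt σ).trace.re))

end Standard

/-! ### The explicit functions of the largest eigenvalue -/

def gRE (p : ℝ) : ℝ := 1 + p * Real.logb 2 p + (1 - p) * Real.logb 2 (1 - p)

def gTr (p : ℝ) : ℝ := p - 1 / 2

def gF (p : ℝ) : ℝ := 1 / 2 - Real.sqrt (p * (1 - p))

def gB (p : ℝ) : ℝ := 2 - Real.sqrt 2 * (Real.sqrt (1 - p) + Real.sqrt p)

/-! ### The form of the result for one distance -/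

/-- The genuine entanglement `E^D_2` of `N`-qubit GHZ-diagonal states is governed by the function
`g` of the largest eigenvalue. Here `p` is the list of eigenvalues of the GHZ-diagonal state and
`b₀` the label of a largest one. -/
structure GenuineLaw (N : ℕ) (D : QOp N → QOp N → ℝ≥0∞) (g : ℝ → ℝ≥0∞) : Prop where
  /-- If the state is not biseparable, then one of its closest biseparable states is GHZ-diagonal
  with eigenvalue `1/2` at `b₀`. -/
  closest : ∀ p ∈ stdSimplex ℝ (Index N), ∀ b₀, (∀ b, p b ≤ p b₀) →
    ghzDiag p ∉ mSeparable N 2 →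
    ∃ q ∈ stdSimplex ℝ (Index N), q b₀ = 1 / 2 ∧ ghzDiag q ∈ mSeparable N 2 ∧
      ∀ ς ∈ mSeparable N 2, D (ghzDiag p) (ghzDiag q) ≤ D (ghzDiag p) ς
  eq_zero : ∀ p ∈ stdSimplex ℝ (Index N), ∀ b₀, (∀ b, p b ≤ p b₀) → p b₀ ≤ 1 / 2 →
    entanglement 2 D (ghzDiag p) = 0
  eq_g : ∀ p ∈ stdSimplex ℝ (Index N), ∀ b₀, (∀ b, p b ≤ p b₀) → 1 / 2 < p b₀ →
    entanglement 2 D (ghzDiag p) = g (p b₀)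
  mono : MonotoneOn g (Set.Ioc (1 / 2) 1)
  strictMono : IsFaithful D → ∀ p p' : ℝ, 1 / 2 < p → p < p' → p' ≤ 1 → g p ≠ ⊤ → g p < g p'
  /-- The genuine entanglement of an arbitrary state is at least that of its GHZ-diagonalisation,
  also after local unitaries. -/
  diagonalisation_le : ∀ ρ : QOp N, IsState ρ → ∀ U : Fin N → Matrix (Fin 2) (Fin 2) ℂ,
    (∀ k, U k ∈ Matrix.unitaryGroup (Fin 2) ℂ) →
    entanglement 2 D (ghzDiag (overlap (localConj U ρ))) ≤ entanglement 2 D ρ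
  /-- Lower bound from a single overlap larger than `1/2`. -/
  lower_bound : ∀ ρ : QOp N, IsState ρ → ∀ U : Fin N → Matrix (Fin 2) (Fin 2) ℂ,
    (∀ k, U k ∈ Matrix.unitaryGroup (Fin 2) ℂ) →
    ∀ b, 1 / 2 < overlap (localConj U ρ) b →
      g (overlap (localConj U ρ) b) ≤ entanglement 2 D ρ

end GHZ

end

noncomputable section

namespace GHZ

open Matrix

/-! ### Expectation values -/

/-! Everything depends on one number, the overlap of a state with a GHZ vector, and on the threshold
1/2. If `ψ` is a product across a bipartition, its amplitudes at `i` and at the flip of `i` are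
products `ab` and `cd` with `a² + c² ≤ 1` and `b² + d² ≤ 1` in modulus, so its overlap with a GHZ
vector is at most 1/2 (`IsPureMSeparable.expVal_ghzVec_le`); convexity extends this to mixtures.
Conversely, the equal mixture of any two GHZ vectors is biseparable
(`half_ghzVec_add_mem_mSeparable`), and the probability vectors with all weights at most 1/2 form
the convex hull of such equal pairs (`mem_convexHull_pairs`). This settles which GHZ-diagonal states
are biseparable.

For a distance, `genuineLaw_of_bound` isolates what is needed: a lower bound by `g` for pairs of
states whose overlaps with a unit vector lie on opposite sides of 1/2, and its attainment when the
dominant eigenvalue is lowered to 1/2 and the others are rescaled proportionally. For a contractive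
convex `D` both come from measure-and-prepare channels. Measuring the projector on `ψ` and preparing
one of two orthogonal reference states compresses a pair to binary mixtures with weights `P` and
`q`; a channel in the opposite direction rebuilds the GHZ-diagonal pair from its binary compression,
which gives equality. Convexity in the second argument replaces `q ≤ 1/2` by 1/2
(`IsContractiveConvex.ghzMix_le`), and an attenuated measurement shows that `g` grows. If the
reference system is fixed to two qubits, `g` is the same for all `N`.

The five standard distances are treated without proving contractivity in general: only the
comparison with a two-outcome measurement is shown. For the trace distance it is the Jordan
decomposition (`expVal_sub_le_trace_abs`), for fidelity and affinity the Cauchy–Schwarz inequality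
applied to each outcome (`re_trace_mul_mul_le`), and for the relative entropy an integrated
variational bound on resolvents (`gRE_le_relativeEntropy`). Attainment is a scalar computation,
since functional calculus acts entrywise on GHZ eigenvalues (`cfc_ghzDiag`). -/

/-- The expectation value `⟨ψ|ρ|ψ⟩`. -/
def expVal {n : Type*} [Fintype n] (ψ : n → ℂ) (ρ : Matrix n n ℂ) : ℝ :=
  (star ψ ⬝ᵥ (ρ.mulVec ψ)).re

section General

variable {n : Type*} [Fintype n]

lemma proj_posSemidef (ψ : n → ℂ) : (proj ψ).PosSemidef :=
  posSemidef_vecMulVec_self_star ψ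

lemma trace_proj_mul (ψ : n → ℂ) (ρ : Matrix n n ℂ) :
    (proj ψ * ρ).trace = star ψ ⬝ᵥ (ρ.mulVec ψ) := by
  rw [proj, vecMulVec_mul, trace_vecMulVec, dotProduct_comm, ← dotProduct_mulVec]

lemma trace_proj (ψ : n → ℂ) : (proj ψ).trace = star ψ ⬝ᵥ ψ := by
  rw [proj, trace_vecMulVec, dotProduct_comm]

lemma expVal_eq_trace (ψ : n → ℂ) (ρ : Matrix n n ℂ) :
    expVal ψ ρ = (proj ψ * ρ).trace.re := by
  rw [trace_proj_mul, expVal]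

lemma expVal_nonneg (ψ : n → ℂ) {ρ : Matrix n n ℂ} (h : ρ.PosSemidef) : 0 ≤ expVal ψ ρ :=
  (Complex.le_def.1 (h.dotProduct_mulVec_nonneg ψ)).1

lemma IsState.expVal_coe (ψ : n → ℂ) {ρ : Matrix n n ℂ} (h : IsState ρ) :
    (expVal ψ ρ : ℂ) = star ψ ⬝ᵥ (ρ.mulVec ψ) :=
  Complex.ext rfl (Complex.le_def.1 (h.1.dotProduct_mulVec_nonneg ψ)).2

lemma expVal_add (ψ : n → ℂ) (ρ σ : Matrix n n ℂ) :
    expVal ψ (ρ + σ) = expVal ψ ρ + expVal ψ σ := by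
  simp [expVal, add_mulVec]

lemma expVal_sub (ψ : n → ℂ) (ρ σ : Matrix n n ℂ) :
    expVal ψ (ρ - σ) = expVal ψ ρ - expVal ψ σ := by
  simp [expVal, sub_mulVec]

lemma expVal_smul (ψ : n → ℂ) (c : ℝ) (ρ : Matrix n n ℂ) :
    expVal ψ (c • ρ) = c * expVal ψ ρ := by
  simp [expVal, smul_mulVec]

lemma expVal_proj (ψ φ : n → ℂ) : expVal ψ (proj φ) = ‖star ψ ⬝ᵥ φ‖ ^ 2 := by
  have : star φ ⬝ᵥ ψ = star (star ψ ⬝ᵥ φ) := by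
    rw [star_dotProduct]
  rw [expVal, proj, vecMulVec_mulVec, this, ← Complex.normSq_eq_norm_sq]
  simp [dotProduct_smul, Complex.normSq_apply]

lemma isState_proj {ψ : n → ℂ} (h : star ψ ⬝ᵥ ψ = 1) : IsState (proj ψ) :=
  ⟨proj_posSemidef ψ, by rw [trace_proj, h]⟩

lemma convex_isState : Convex ℝ {ρ : Matrix n n ℂ | IsState ρ} := by
  rintro ρ ⟨h1, h2⟩ σ ⟨h3, h4⟩ a b ha hb hab
  refine ⟨(h1.smul ha).add (h3.smul hb), ?_⟩
  rw [trace_add, trace_smul, trace_smul, h2, h4, ← add_smul, hab, one_smul]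

lemma proj_mul_self {ψ : n → ℂ} (h : star ψ ⬝ᵥ ψ = 1) : proj ψ * proj ψ = proj ψ := by
  rw [proj, vecMulVec_mul_vecMulVec, h, one_smul]

lemma proj_isHermitian (ψ : n → ℂ) : (proj ψ).IsHermitian := (proj_posSemidef ψ).1

/-! ### Positivity of projections and of traces -/

lemma one_sub_posSemidef_of_idempotent [DecidableEq n] {E : Matrix n n ℂ} (h : E.IsHermitian)
    (h2 : E * E = E) : (1 - E).PosSemidef := by
  have h3 : (1 - E)ᴴ * (1 - E) = 1 - E := by
    rw [conjTranspose_sub, conjTranspose_one, h.eq]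
    simp [mul_sub, sub_mul, h2]
  rw [← h3]
  exact posSemidef_conjTranspose_mul_self _

lemma re_trace_nonneg {A : Matrix n n ℂ} (h : A.PosSemidef) : 0 ≤ A.trace.re :=
  (Complex.le_def.1 h.trace_nonneg).1

open scoped MatrixOrder in
lemma exists_eq_conjTranspose_mul_self {B : Matrix n n ℂ} (hB : B.PosSemidef) :
    ∃ C : Matrix n n ℂ, B = Cᴴ * C := by
  classical
  exact CStarAlgebra.nonneg_iff_eq_star_mul_self.mp hB.nonneg

/-- The trace of a product of two positive semidefinite matrices is nonnegative. -/
lemma trace_mul_nonneg {A B : Matrix n n ℂ} (hA : A.PosSemidef) (hB : B.PosSemidef) :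
    0 ≤ (A * B).trace := by
  obtain ⟨C, rfl⟩ := exists_eq_conjTranspose_mul_self hB
  rw [← Matrix.mul_assoc, trace_mul_comm, ← Matrix.mul_assoc]
  exact (hA.mul_mul_conjTranspose_same C).trace_nonneg

lemma re_trace_mul_nonneg {A B : Matrix n n ℂ} (hA : A.PosSemidef) (hB : B.PosSemidef) :
    0 ≤ (A * B).trace.re :=
  (Complex.le_def.1 (trace_mul_nonneg hA hB)).1

lemma expVal_le_trace {ψ : n → ℂ} (hψ : star ψ ⬝ᵥ ψ = 1) {A : Matrix n n ℂ}
    (hA : A.PosSemidef) : expVal ψ A ≤ A.trace.re := by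
  classical
  have := re_trace_mul_nonneg
    (one_sub_posSemidef_of_idempotent (proj_isHermitian ψ) (proj_mul_self hψ)) hA
  rw [sub_mul, one_mul, trace_sub, Complex.sub_re, ← expVal_eq_trace] at this
  linarith

lemma IsState.expVal_le_one {ψ : n → ℂ} (hψ : star ψ ⬝ᵥ ψ = 1) {ρ : Matrix n n ℂ}
    (h : IsState ρ) : expVal ψ ρ ≤ 1 :=
  (expVal_le_trace hψ h.1).trans_eq (by rw [h.2, Complex.one_re])

end General

/-! ### The GHZ basis -/

section Basis

variable {N : ℕ}

/-- Flip all bits. -/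
def flip {ι : Type*} (x : ι → Fin 2) : ι → Fin 2 := fun k => Fin.rev (x k)

@[simp] lemma flip_flip {ι : Type*} (x : ι → Fin 2) : flip (flip x) = x := by
  funext k; simp [flip]

lemma rev_ne_self (a : Fin 2) : Fin.rev a ≠ a := by
  revert a; decide

lemma eq_or_eq_rev (a b : Fin 2) : a = b ∨ a = Fin.rev b := by
  revert a b; decide

lemma flip_apply_ne {ι : Type*} (x : ι → Fin 2) (k : ι) : flip x k ≠ x k := rev_ne_self _

lemma flip_ne {ι : Type*} [Nonempty ι] (x : ι → Fin 2) : flip x ≠ x := fun h =>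
  flip_apply_ne x (Classical.arbitrary ι) (congrFun h _)

lemma ghzVec_apply (b : Index N) (x : Bits N) :
    ghzVec b x = ((Real.sqrt 2 : ℝ) : ℂ)⁻¹ *
      ((if x = b.1.1 then 1 else 0) + ((b.2 : ℤ) : ℂ) * (if x = flip b.1.1 then 1 else 0)) := by
  simp only [ghzVec, Pi.smul_apply, Pi.add_apply, smul_eq_mul, Pi.single_apply]
  rfl

lemma sqrt_two_inv_mul_self : ((Real.sqrt 2 : ℝ) : ℂ)⁻¹ * ((Real.sqrt 2 : ℝ) : ℂ)⁻¹ = 1 / 2 := by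
  rw [← mul_inv, ← Complex.ofReal_mul, Real.mul_self_sqrt (by norm_num)]
  norm_num

lemma star_ghzVec (b : Index N) : star (ghzVec b) = ghzVec b := by
  funext x
  rw [Pi.star_apply, ghzVec_apply]
  split_ifs <;> simp

lemma ghzDiag_isHermitian (p : Index N → ℝ) : (ghzDiag p).IsHermitian := by
  rw [IsHermitian, ghzDiag, conjTranspose_sum]
  refine Finset.sum_congr rfl fun b _ => ?_
  rw [conjTranspose_smul, (proj_isHermitian _).eq]; simp

lemma ghzDiag_add (p q : Index N → ℝ) : ghzDiag (p + q) = ghzDiag p + ghzDiag q := by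
  simp [ghzDiag, add_smul, Finset.sum_add_distrib]

lemma ghzDiag_smul (c : ℝ) (p : Index N → ℝ) : ghzDiag (c • p) = c • ghzDiag p := by
  simp [ghzDiag, Finset.smul_sum, mul_smul]

lemma ghzDiag_sub (p q : Index N → ℝ) : ghzDiag (p - q) = ghzDiag p - ghzDiag q := by
  simp [ghzDiag, sub_smul, Finset.sum_sub_distrib]

lemma ghzDiag_single (b : Index N) : ghzDiag (Pi.single b 1) = proj (ghzVec b) := by
  rw [ghzDiag, Finset.sum_eq_single b]
  · simp
  · intro c _ hc; simp [hc]
  · simp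

variable [NeZero N]

lemma leading_eq_zero (i : {i : Bits N // ∀ k : Fin N, (k : ℕ) = 0 → i k = 0}) : i.1 0 = 0 :=
  i.2 0 (by simp)

lemma val_ne_flip_val (i j : {i : Bits N // ∀ k : Fin N, (k : ℕ) = 0 → i k = 0}) :
    i.1 ≠ flip j.1 := by
  intro h
  have := congrFun h 0
  rw [leading_eq_zero, flip, leading_eq_zero] at this
  exact absurd this (by decide)

/-- The bit string with leading bit `0` among `x` and its flip. -/
def leader (x : Bits N) : {i : Bits N // ∀ k : Fin N, (k : ℕ) = 0 → i k = 0} :=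
  if h : x 0 = 0 then ⟨x, fun k hk => by rwa [show k = 0 from Fin.ext (by simpa using hk)]⟩
  else ⟨flip x, fun k hk => by
    rw [show k = 0 from Fin.ext (by simpa using hk), flip]
    revert h; generalize x 0 = a; revert a; decide⟩

lemma leader_cases (x : Bits N) : x = (leader x).1 ∨ x = flip (leader x).1 := by
  unfold leader
  split_ifs <;> simp

lemma leader_val (i : {i : Bits N // ∀ k : Fin N, (k : ℕ) = 0 → i k = 0}) : leader i.1 = i := by
  have := leading_eq_zero i
  simp [leader, this]

lemma leader_flip_val (i : {i : Bits N // ∀ k : Fin N, (k : ℕ) = 0 → i k = 0}) :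
    leader (flip i.1) = i := by
  have h := leading_eq_zero i
  have : flip i.1 0 ≠ 0 := by rw [flip, h]; decide
  simp [leader, this]

lemma ghzVec_eq_zero {b : Index N} {x : Bits N} (h : b.1 ≠ leader x) : ghzVec b x = 0 := by
  rw [ghzVec_apply, if_neg, if_neg]
  · simp
  · rintro rfl; exact h (leader_flip_val _).symm
  · rintro rfl; exact h (leader_val _).symm

lemma ghzVec_val (i : {i : Bits N // ∀ k : Fin N, (k : ℕ) = 0 → i k = 0}) (s : ℤˣ) :
    ghzVec (i, s) i.1 = ((Real.sqrt 2 : ℝ) : ℂ)⁻¹ := by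
  rw [ghzVec_apply, if_pos rfl, if_neg (val_ne_flip_val _ _)]
  simp

lemma ghzVec_flip (i : {i : Bits N // ∀ k : Fin N, (k : ℕ) = 0 → i k = 0}) (s : ℤˣ) :
    ghzVec (i, s) (flip i.1) = ((Real.sqrt 2 : ℝ) : ℂ)⁻¹ * ((s : ℤ) : ℂ) := by
  rw [ghzVec_apply, if_pos rfl, if_neg (val_ne_flip_val _ _).symm]
  simp

lemma sum_units_int {M : Type*} [AddCommMonoid M] (f : ℤˣ → M) : ∑ s, f s = f 1 + f (-1) := by
  rw [show (Finset.univ : Finset ℤˣ) = {1, -1} from rfl, Finset.sum_pair (by decide)]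

/-- The GHZ basis splits the space into the planes spanned by a basis string and its flip, which
`leader` labels. In each plane the operator is a 2 × 2 matrix with equal diagonal entries and equal
off-diagonal entries. This entrywise form gives completeness of the basis and later the
identification of the twirl. -/
lemma ghzDiag_apply (p : Index N → ℝ) (x y : Bits N) :
    ghzDiag p x y = if leader x = leader y then
      1 / 2 * ((p (leader x, 1) : ℂ) + (if x = y then 1 else -1) * (p (leader x, -1) : ℂ)) else 0 := by
  have h0 : ghzDiag p x y = ∑ b, (p b : ℂ) * (ghzVec b x * ghzVec b y) := by
    simp only [ghzDiag, Matrix.sum_apply, Matrix.smul_apply, proj, vecMulVec_apply, star_ghzVec,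
      smul_eq_mul]
  rw [h0, Fintype.sum_prod_type, Finset.sum_eq_single (leader x)]
  · split_ifs with h h'
    · subst h'
      rw [sum_units_int]
      rcases leader_cases x with hx | hx <;> generalize leader x = i at hx <;> subst hx
      · simp only [ghzVec_val, sqrt_two_inv_mul_self]; ring
      · have h2 := sqrt_two_inv_mul_self
        simp only [ghzVec_flip]
        norm_num
        linear_combination ((p (i, 1) : ℂ) + p (i, -1)) * h2
    · rw [sum_units_int]
      have hx := leader_cases x
      have hy := leader_cases y
      rw [← h] at hy
      generalize leader x = i at hx hy
      rcases hx with hx | hx <;> rcases hy with hy | hy <;> subst hx <;> subst hy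
      · exact absurd rfl h'
      · simp only [ghzVec_val, ghzVec_flip, ← mul_assoc]
        simp only [mul_assoc _ _ (((Real.sqrt 2 : ℝ) : ℂ)⁻¹), sqrt_two_inv_mul_self]
        norm_num; ring
      · simp only [ghzVec_val, ghzVec_flip]
        simp only [mul_right_comm _ _ (((Real.sqrt 2 : ℝ) : ℂ)⁻¹), sqrt_two_inv_mul_self]
        norm_num; ring
      · exact absurd rfl h'
    · refine Finset.sum_eq_zero fun s _ => ?_
      rw [ghzVec_eq_zero (x := y) h]; simp
  · intro i _ hi
    refine Finset.sum_eq_zero fun s _ => ?_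
    rw [ghzVec_eq_zero (x := x) hi]; simp
  · simp

lemma ghzDiag_one : ghzDiag (fun _ : Index N => 1) = 1 := by
  ext x y
  rw [ghzDiag_apply, Matrix.one_apply]
  split_ifs with h h' h'
  · norm_num
  · norm_num
  · exact absurd (congrArg leader h') h
  · rfl

lemma star_ghzVec_dotProduct (b b' : Index N) :
    star (ghzVec b) ⬝ᵥ ghzVec b' = if b = b' then 1 else 0 := by
  obtain ⟨i, s⟩ := b
  obtain ⟨j, t⟩ := b'
  rw [star_ghzVec, ghzVec, smul_dotProduct, add_dotProduct, smul_dotProduct, single_one_dotProduct,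
    single_one_dotProduct]
  change _ • (ghzVec (j, t) i.1 + _ • ghzVec (j, t) (flip i.1)) = _
  by_cases hij : i = j
  · subst hij
    rw [ghzVec_val, ghzVec_flip]
    simp only [smul_eq_mul, mul_add]
    rw [mul_left_comm, ← mul_assoc _ _ ((t : ℤ) : ℂ), sqrt_two_inv_mul_self]
    rcases Int.units_eq_one_or s with rfl | rfl <;> rcases Int.units_eq_one_or t with rfl | rfl <;>
      norm_num
  · rw [ghzVec_eq_zero, ghzVec_eq_zero, if_neg]
    · simp
    · rintro h; exact hij (congrArg Prod.fst h)
    · rw [leader_flip_val]; exact Ne.symm hij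
    · rw [leader_val]; exact Ne.symm hij

lemma ghzVec_unit (b : Index N) : star (ghzVec b) ⬝ᵥ ghzVec b = 1 := by
  rw [star_ghzVec_dotProduct, if_pos rfl]

lemma proj_ghzVec_mul (b b' : Index N) :
    proj (ghzVec b) * proj (ghzVec b') = if b = b' then proj (ghzVec b) else 0 := by
  rw [proj, proj, vecMulVec_mul_vecMulVec, star_ghzVec_dotProduct]
  split_ifs with h
  · rw [one_smul, h]
  · simp

lemma ghzDiag_mul (p q : Index N → ℝ) : ghzDiag p * ghzDiag q = ghzDiag (p * q) := by
  simp only [ghzDiag, Finset.sum_mul, Finset.mul_sum, smul_mul_assoc, mul_smul_comm,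
    proj_ghzVec_mul, smul_ite, smul_zero, Finset.sum_ite_eq', Finset.mem_univ,
    if_true, Pi.mul_apply, Complex.ofReal_mul, smul_smul, mul_comm]

lemma ghzDiag_mulVec_ghzVec (p : Index N → ℝ) (b : Index N) :
    ghzDiag p *ᵥ ghzVec b = (p b : ℂ) • ghzVec b := by
  simp only [ghzDiag, sum_mulVec, smul_mulVec, proj, vecMulVec_mulVec, star_ghzVec_dotProduct]
  rw [Finset.sum_eq_single b]
  · simp
  · intro c _ hc; simp [hc]
  · simp

lemma expVal_ghzDiag (p : Index N → ℝ) (b : Index N) : expVal (ghzVec b) (ghzDiag p) = p b := by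
  rw [expVal, ghzDiag_mulVec_ghzVec, dotProduct_smul, ghzVec_unit]; simp

lemma trace_ghzDiag (p : Index N → ℝ) : (ghzDiag p).trace = ((∑ b, p b : ℝ) : ℂ) := by
  simp [ghzDiag, trace_sum, trace_smul, trace_proj, ghzVec_unit]

lemma isState_ghzDiag {p : Index N → ℝ} (hp : p ∈ stdSimplex ℝ (Index N)) :
    IsState (ghzDiag p) := by
  refine ⟨?_, by rw [trace_ghzDiag, hp.2]; simp⟩
  refine posSemidef_sum _ fun b _ => ?_
  rw [Complex.coe_smul]
  exact (proj_posSemidef _).smul (hp.1 b)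

lemma overlap_mem_stdSimplex {ρ : QOp N} (h : IsState ρ) : overlap ρ ∈ stdSimplex ℝ (Index N) := by
  refine ⟨fun b => expVal_nonneg (ghzVec b) h.1, ?_⟩
  have : ∑ b, overlap ρ b = (ghzDiag (fun _ : Index N => 1) * ρ).trace.re := by
    simp only [ghzDiag, Finset.sum_mul, trace_sum, Complex.re_sum, Complex.ofReal_one, one_smul]
    exact Finset.sum_congr rfl fun b _ => expVal_eq_trace _ _
  rw [this, ghzDiag_one, one_mul, h.2, Complex.one_re]

end Basis

/-! ### Tensor products of single-qubit operators -/

section Tensor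

variable {ι : Type*} [Fintype ι]

/-- The tensor product of a family of single-qubit operators. -/
def tensorOp (U : ι → Matrix (Fin 2) (Fin 2) ℂ) : Matrix (ι → Fin 2) (ι → Fin 2) ℂ :=
  Matrix.of fun x y => ∏ k, U k (x k) (y k)

lemma tensorOp_conjTranspose (U : ι → Matrix (Fin 2) (Fin 2) ℂ) :
    (tensorOp U)ᴴ = tensorOp fun k => (U k)ᴴ := by
  ext x y
  simp [tensorOp, conjTranspose_apply]

lemma tensorOp_one : tensorOp (fun _ : ι => (1 : Matrix (Fin 2) (Fin 2) ℂ)) = 1 := by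
  ext x y
  simp only [tensorOp, Matrix.of_apply, Matrix.one_apply]
  rw [Fintype.prod_ite_zero]
  simp [funext_iff]

variable [DecidableEq ι]

lemma tensorOp_mul (U V : ι → Matrix (Fin 2) (Fin 2) ℂ) :
    tensorOp U * tensorOp V = tensorOp fun k => U k * V k := by
  ext x y
  simp only [tensorOp, Matrix.mul_apply, Matrix.of_apply, ← Finset.prod_mul_distrib]
  rw [Finset.prod_univ_sum, Fintype.piFinset_univ]

lemma tensorOp_conjTranspose_mul_self {U : ι → Matrix (Fin 2) (Fin 2) ℂ}
    (hU : ∀ k, U k ∈ unitaryGroup (Fin 2) ℂ) : (tensorOp U)ᴴ * tensorOp U = 1 := by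
  rw [tensorOp_conjTranspose, tensorOp_mul, ← tensorOp_one]
  congr 1
  funext k
  exact mem_unitaryGroup_iff'.1 (hU k)

lemma tensorOp_mul_conjTranspose_self {U : ι → Matrix (Fin 2) (Fin 2) ℂ}
    (hU : ∀ k, U k ∈ unitaryGroup (Fin 2) ℂ) : tensorOp U * (tensorOp U)ᴴ = 1 := by
  rw [tensorOp_conjTranspose, tensorOp_mul, ← tensorOp_one]
  congr 1
  funext k
  exact mem_unitaryGroup_iff.1 (hU k)

end Tensor

/-! ### Separability -/

lemma sum_norm_sq_eq_one_iff {n : Type*} [Fintype n] (ψ : n → ℂ) :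
    ∑ y, ‖ψ y‖ ^ 2 = 1 ↔ star ψ ⬝ᵥ ψ = 1 := by
  have : star ψ ⬝ᵥ ψ = ((∑ y, ‖ψ y‖ ^ 2 : ℝ) : ℂ) := by
    simp [dotProduct, Complex.conj_mul']
  rw [this, Complex.ofReal_eq_one]

lemma unit_mulVec {n : Type*} [Fintype n] [DecidableEq n] {A : Matrix n n ℂ} (hA : Aᴴ * A = 1)
    {ψ : n → ℂ} (hψ : star ψ ⬝ᵥ ψ = 1) : star (A *ᵥ ψ) ⬝ᵥ (A *ᵥ ψ) = 1 := by
  rw [star_mulVec, ← dotProduct_mulVec, mulVec_mulVec, hA, one_mulVec, hψ]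

lemma mul_proj_mul {n : Type*} [Fintype n] (A : Matrix n n ℂ) (ψ : n → ℂ) :
    A * proj ψ * Aᴴ = proj (A *ᵥ ψ) := by
  rw [proj, proj, mul_vecMulVec, vecMulVec_mul, star_mulVec]

lemma expVal_conj {n : Type*} [Fintype n] (A ρ : Matrix n n ℂ) (ψ : n → ℂ) :
    expVal ψ (A * ρ * Aᴴ) = expVal (Aᴴ *ᵥ ψ) ρ := by
  rw [expVal, expVal, star_mulVec, conjTranspose_conjTranspose, ← dotProduct_mulVec,
    mulVec_mulVec, mulVec_mulVec, Matrix.mul_assoc]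

section Separable

variable {N M : ℕ}

/-- Splitting a bit string along a partition. -/
def splitBits (part : Fin N → Fin M) :
    Bits N ≃ ((k : Fin M) → {i : Fin N // part i = k} → Fin 2) where
  toFun x _ i := x i.1
  invFun z i := z (part i) ⟨i, rfl⟩
  left_inv _ := rfl
  right_inv z := by
    funext k i
    obtain ⟨i, rfl⟩ := i
    rfl

/-- Distributivity: choosing a substring for each part independently is the same as choosing the
whole string. This factorises norms and matrix products along a partition. -/
lemma prod_sum_splitBits {R : Type*} [CommSemiring R] (part : Fin N → Fin M)
    (f : (k : Fin M) → ({i : Fin N // part i = k} → Fin 2) → R) :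
    ∏ k, ∑ z, f k z = ∑ x : Bits N, ∏ k, f k (fun i => x i.1) := by
  rw [Finset.prod_univ_sum, Fintype.piFinset_univ]
  exact ((splitBits part).sum_comp fun z => ∏ k, f k (z k)).symm

lemma IsPureMSeparable.unit {ψ : Bits N → ℂ} (h : IsPureMSeparable N M ψ) :
    star ψ ⬝ᵥ ψ = 1 := by
  obtain ⟨part, -, φ, hφ, hψ⟩ := h
  rw [← sum_norm_sq_eq_one_iff]
  simp only [hψ, norm_prod, ← Finset.prod_pow]
  rw [← prod_sum_splitBits part fun k z => ‖φ k z‖ ^ 2]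
  simp [hφ]

/-- A local operator is also a tensor product along any partition, so it acts on each factor
separately, and unitarity of the restricted products keeps the factors normalised. -/
lemma IsPureMSeparable.localOp_mulVec {ψ : Bits N → ℂ} (h : IsPureMSeparable N M ψ)
    {U : Fin N → Matrix (Fin 2) (Fin 2) ℂ} (hU : ∀ k, U k ∈ unitaryGroup (Fin 2) ℂ) :
    IsPureMSeparable N M (localOp U *ᵥ ψ) := by
  obtain ⟨part, hp, φ, hφ, hψ⟩ := h
  refine ⟨part, hp, fun k => tensorOp (fun i : {i // part i = k} => U i.1) *ᵥ φ k, fun k => ?_,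
    fun x => ?_⟩
  · have h1 := tensorOp_conjTranspose_mul_self (U := fun i : {i // part i = k} => U i.1)
      fun i => hU i.1
    have h2 := unit_mulVec h1 ((sum_norm_sq_eq_one_iff _).1 (hφ k))
    exact (sum_norm_sq_eq_one_iff _).2 h2
  · simp only [mulVec, dotProduct, tensorOp, Matrix.of_apply, localOp]
    rw [prod_sum_splitBits part fun k z =>
      (∏ i : {i // part i = k}, U i.1 (x i.1) (z i)) * φ k z]
    refine Finset.sum_congr rfl fun y _ => ?_
    rw [Finset.prod_mul_distrib, hψ y,
      Fintype.prod_fiberwise part fun i => U i (x i) (y i)]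

lemma mSeparable_subset_isState : mSeparable N M ⊆ {ρ | IsState ρ} := by
  refine convexHull_min ?_ convex_isState
  rintro _ ⟨ψ, hψ, rfl⟩
  exact isState_proj hψ.unit

/-! ### Overlaps of biseparable states with GHZ vectors -/

lemma add_norm_sq_flip_le {ι : Type*} [Fintype ι] [DecidableEq ι] [Nonempty ι]
    {φ : (ι → Fin 2) → ℂ} (h : ∑ y, ‖φ y‖ ^ 2 = 1) (x : ι → Fin 2) :
    ‖φ x‖ ^ 2 + ‖φ (flip x)‖ ^ 2 ≤ 1 := by
  rw [← h, ← Finset.sum_pair (f := fun y => ‖φ y‖ ^ 2) (flip_ne x).symm]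
  exact Finset.sum_le_sum_of_subset_of_nonneg (Finset.subset_univ _) fun _ _ _ => by positivity

/-- The overlap of a biseparable pure state with a GHZ basis state is at most `1/2`. -/
lemma IsPureMSeparable.expVal_ghzVec_le {ψ : Bits N → ℂ} (h : IsPureMSeparable N 2 ψ)
    (b : Index N) : expVal (ghzVec b) (proj ψ) ≤ 1 / 2 := by
  obtain ⟨part, hp, φ, hφ, hψ⟩ := h
  obtain ⟨i, s⟩ := b
  have hne : ∀ k, Nonempty {m // part m = k} := fun k => (hp k).elim fun m hm => ⟨⟨m, hm⟩⟩
  have h0 := add_norm_sq_flip_le (hφ 0) (fun m => i.1 m.1)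
  have h1 := add_norm_sq_flip_le (hφ 1) (fun m => i.1 m.1)
  have hdot : star (ghzVec (i, s)) ⬝ᵥ ψ =
      ((Real.sqrt 2 : ℝ) : ℂ)⁻¹ * (ψ i.1 + ((s : ℤ) : ℂ) * ψ (flip i.1)) := by
    rw [star_ghzVec, ghzVec, smul_dotProduct, add_dotProduct, smul_dotProduct,
      single_one_dotProduct, single_one_dotProduct]
    rfl
  have hs : ‖((s : ℤ) : ℂ)‖ = 1 := by
    rcases Int.units_eq_one_or s with rfl | rfl <;> simp
  -- Since `ab + cd ≤ ((a² + c²) + (b² + d²)) / 2`, the two normalisation bounds `h0` and `h1`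
  -- suffice. Nonemptiness of both parts matters here: otherwise a string of a part would coincide
  -- with its flip.
  have hle : ‖ψ i.1 + ((s : ℤ) : ℂ) * ψ (flip i.1)‖ ≤ 1 := by
    refine (norm_add_le _ _).trans ?_
    rw [norm_mul, hs, one_mul, hψ, hψ, norm_prod, norm_prod, Fin.prod_univ_two, Fin.prod_univ_two]
    change ‖φ 0 fun m => i.1 m.1‖ * ‖φ 1 fun m => i.1 m.1‖ +
      ‖φ 0 (flip fun m => i.1 m.1)‖ * ‖φ 1 (flip fun m => i.1 m.1)‖ ≤ 1
    nlinarith [sq_nonneg (‖φ 0 fun m => i.1 m.1‖ - ‖φ 1 fun m => i.1 m.1‖),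
      sq_nonneg (‖φ 0 (flip fun m => i.1 m.1)‖ - ‖φ 1 (flip fun m => i.1 m.1)‖)]
  have h2 : ‖((Real.sqrt 2 : ℝ) : ℂ)⁻¹‖ ^ 2 = 1 / 2 := by
    rw [norm_inv, inv_pow, Complex.norm_real, Real.norm_eq_abs, sq_abs,
      Real.sq_sqrt (by norm_num)]
    norm_num
  rw [expVal_proj, hdot, norm_mul, mul_pow, h2]
  nlinarith [norm_nonneg (ψ i.1 + ((s : ℤ) : ℂ) * ψ (flip i.1))]

lemma overlap_localConj (U : Fin N → Matrix (Fin 2) (Fin 2) ℂ) (ρ : QOp N) (b : Index N) :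
    overlap (localConj U ρ) b = expVal ((localOp U)ᴴ *ᵥ ghzVec b) ρ :=
  expVal_conj (localOp U) ρ (ghzVec b)

lemma convex_expVal_le {n : Type*} [Fintype n] (ψ : n → ℂ) (c : ℝ) :
    Convex ℝ {ρ : Matrix n n ℂ | expVal ψ ρ ≤ c} := by
  intro ρ hρ σ hσ a b ha hb hab
  simp only [Set.mem_ofPred_eq] at *
  rw [expVal_add, expVal_smul, expVal_smul]
  calc a * expVal ψ ρ + b * expVal ψ σ ≤ a * c + b * c := by gcongr
    _ = c := by rw [← add_mul, hab, one_mul]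

/-- An upper bound on an expectation value cuts out a half-space, so pure generators suffice; there
the local unitary can be absorbed into the product vector. -/
lemma overlap_localConj_le_of_mem_mSeparable {σ : QOp N} (h : σ ∈ mSeparable N 2)
    {U : Fin N → Matrix (Fin 2) (Fin 2) ℂ} (hU : ∀ k, U k ∈ unitaryGroup (Fin 2) ℂ)
    (b : Index N) : overlap (localConj U σ) b ≤ 1 / 2 := by
  rw [overlap_localConj]
  refine convexHull_min ?_ (convex_expVal_le ((localOp U)ᴴ *ᵥ ghzVec b) (1 / 2)) h
  rintro _ ⟨ψ, hψ, rfl⟩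
  rw [Set.mem_ofPred_eq, ← expVal_conj, mul_proj_mul]
  exact (hψ.localOp_mulVec hU).expVal_ghzVec_le b

lemma expVal_ghzVec_le_of_mem_mSeparable {σ : QOp N} (h : σ ∈ mSeparable N 2)
    (b : Index N) : expVal (ghzVec b) σ ≤ 1 / 2 := by
  refine convexHull_min ?_ (convex_expVal_le (ghzVec b) (1 / 2)) h
  rintro _ ⟨ψ, hψ, rfl⟩
  exact hψ.expVal_ghzVec_le b

/-! ### Mixtures of two GHZ basis states -/

lemma isPureMSeparable_smul_single (hN : 2 ≤ N) (i : Bits N) {c : ℂ} (hc : ‖c‖ = 1) :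
    IsPureMSeparable N 2 (c • Pi.single i 1) := by
  -- The bipartition is the first qubit against the rest, with the phase `c` put on the first
  -- factor.
  refine ⟨fun m => if (m : ℕ) = 0 then 0 else 1, fun k => ?_,
    fun k y => (if k = 0 then c else 1) * if y = fun m => i m.1 then 1 else 0, fun k => ?_,
    fun x => ?_⟩
  · fin_cases k
    · exact ⟨⟨0, by omega⟩, by simp⟩
    · exact ⟨⟨1, by omega⟩, by simp⟩
  · rw [Finset.sum_eq_single (fun m => i m.1)]
    · by_cases hk : k = 0 <;> simp [hk, hc]
    · intro y _ hy; simp [hy]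
    · simp
  · rw [Fin.prod_univ_two]
    beta_reduce
    by_cases hx : x = i
    · subst hx; simp
    · have : ¬ ((∀ m : Fin N, (m : ℕ) = 0 → x m = i m) ∧ ∀ m : Fin N, (m : ℕ) ≠ 0 → x m = i m) :=
        fun h => hx (funext fun m => (em ((m : ℕ) = 0)).elim (h.1 m) (h.2 m))
      rw [not_and_or] at this
      rcases this with h | h
      · rw [if_neg (c := (fun m : {m : Fin N // _ = (0 : Fin 2)} => x m.1) = _)]
        · simp [hx]
        · exact fun h' => h fun m hm => congrFun h' ⟨m, by simp [hm]⟩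
      · rw [if_neg (c := (fun m : {m : Fin N // _ = (1 : Fin 2)} => x m.1) = _)]
        · simp [hx]
        · exact fun h' => h fun m hm => congrFun h' ⟨m, by simp [hm]⟩

lemma isPureMSeparable_two_level {part : Fin N → Fin 2} (hp : Function.Surjective part)
    (i : Bits N) {γ : Fin 2 → ℂ} (hγ : ∀ k, ‖γ k‖ = 1) :
    IsPureMSeparable N 2 fun x => ∏ k, ((Real.sqrt 2 : ℝ) : ℂ)⁻¹ *
      ((if ∀ m, part m = k → x m = i m then 1 else 0) +
        γ k * (if ∀ m, part m = k → x m = flip i m then 1 else 0)) := by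
  refine ⟨part, hp, fun k y => ((Real.sqrt 2 : ℝ) : ℂ)⁻¹ *
    ((if y = fun m => i m.1 then 1 else 0) + γ k * (if y = flip fun m => i m.1 then 1 else 0)),
    fun k => ?_, fun x => ?_⟩
  · obtain ⟨m, hm⟩ := hp k
    have : Nonempty {m // part m = k} := ⟨⟨m, hm⟩⟩
    have hne := flip_ne (fun m : {m // part m = k} => i m.1)
    rw [← Finset.sum_subset (Finset.subset_univ {fun m => i m.1, flip fun m => i m.1}),
      Finset.sum_pair hne.symm]
    · simp only [if_true, if_neg hne, if_neg hne.symm, mul_zero, add_zero, zero_add, mul_one,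
        norm_mul, hγ, norm_inv, Complex.norm_real, Real.norm_eq_abs, inv_pow, sq_abs]
      rw [Real.sq_sqrt (by norm_num)]; norm_num
    · intro y _ hy
      simp only [Finset.mem_insert, Finset.mem_singleton, not_or] at hy
      simp [hy.1, hy.2]
  · refine Finset.prod_congr rfl fun k _ => ?_
    have h1 : ((fun m : {m // part m = k} => x m.1) = fun m => i m.1) ↔
        ∀ m, part m = k → x m = i m := by simp [funext_iff]
    have h2 : ((fun m : {m // part m = k} => x m.1) = flip fun m => i m.1) ↔
        ∀ m, part m = k → x m = flip i m := by simp [funext_iff, flip]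
    simp only [h1, h2]

lemma norm_intUnit (s : ℤˣ) : ‖((s : ℤ) : ℂ)‖ = 1 := by
  rcases Int.units_eq_one_or s with rfl | rfl <;> simp

/-- Two GHZ basis vectors belonging to different bit strings span product vectors of the
bipartition into the qubits where the strings agree and those where they differ. -/
lemma isPureMSeparable_ghzVec_add [NeZero N]
    {i j : {i : Bits N // ∀ k : Fin N, (k : ℕ) = 0 → i k = 0}}
    (hij : i ≠ j) (s t : ℤˣ) {c : ℂ} (hc : c ^ 2 = ((s : ℤ) : ℂ) * ((t : ℤ) : ℂ)) :
    IsPureMSeparable N 2 (((Real.sqrt 2 : ℝ) : ℂ)⁻¹ • (ghzVec (i, s) + c • ghzVec (j, t))) := by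
  have hc1 : ‖c‖ = 1 := by
    have : ‖c‖ ^ 2 = 1 := by rw [← norm_pow, hc, norm_mul, norm_intUnit, norm_intUnit, one_mul]
    exact (pow_eq_one_iff_of_nonneg (norm_nonneg _) two_ne_zero).1 this
  set part : Fin N → Fin 2 := fun m => if i.1 m = j.1 m then 0 else 1 with hpart
  have hp0 : ∀ m, part m = 0 ↔ j.1 m = i.1 m := fun m => by
    by_cases h : i.1 m = j.1 m <;> simp [hpart, h, eq_comm]
  have hp1 : ∀ m, part m = 1 ↔ j.1 m = flip i.1 m := fun m => by
    rcases eq_or_eq_rev (j.1 m) (i.1 m) with h | h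
    · simp [hpart, h, flip, (rev_ne_self _).symm]
    · simp [hpart, h, flip, (rev_ne_self _).symm]
  have hsurj : Function.Surjective part := by
    intro k
    fin_cases k
    · exact ⟨0, (hp0 0).2 (by rw [leading_eq_zero, leading_eq_zero])⟩
    · obtain ⟨m, hm⟩ := Function.ne_iff.1 (fun h => hij (Subtype.ext h) : i.1 ≠ j.1)
      exact ⟨m, by simp [hpart, hm]⟩
  have hcov : ∀ m, part m = 0 ∨ part m = 1 := fun m => by
    generalize part m = a; revert a; decide
  -- Expanding the product of the two factors gives the strings `i`, `j`, flip of `j` and flip of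
  -- `i` with coefficients `1`, `c`, `ct` and `c²t`. The last one equals `s` because `c² = st` and
  -- `t² = 1`.
  convert isPureMSeparable_two_level hsurj i.1 (γ := ![c * ((t : ℤ) : ℂ), c]) (fun k => by
    fin_cases k
    · exact (norm_mul _ _).trans (by rw [hc1, norm_intUnit, one_mul])
    · exact hc1) using 1
  funext x
  have e1 : x = i.1 ↔ (∀ m, part m = 0 → x m = i.1 m) ∧ ∀ m, part m = 1 → x m = i.1 m :=
    ⟨fun h => by simp [h], fun h => funext fun m => (hcov m).elim (h.1 m) (h.2 m)⟩
  have e2 : x = flip i.1 ↔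
      (∀ m, part m = 0 → x m = flip i.1 m) ∧ ∀ m, part m = 1 → x m = flip i.1 m :=
    ⟨fun h => by simp [h], fun h => funext fun m => (hcov m).elim (h.1 m) (h.2 m)⟩
  have e3 : x = j.1 ↔ (∀ m, part m = 0 → x m = i.1 m) ∧ ∀ m, part m = 1 → x m = flip i.1 m := by
    refine ⟨fun h => ⟨fun m hm => h ▸ (hp0 m).1 hm, fun m hm => h ▸ (hp1 m).1 hm⟩,
      fun h => funext fun m => (hcov m).elim (fun hm => ?_) (fun hm => ?_)⟩
    · rw [h.1 m hm, (hp0 m).1 hm]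
    · rw [h.2 m hm, (hp1 m).1 hm]
  have e4 : x = flip j.1 ↔
      (∀ m, part m = 0 → x m = flip i.1 m) ∧ ∀ m, part m = 1 → x m = i.1 m := by
    have f0 : ∀ m, part m = 0 → flip j.1 m = flip i.1 m := fun m hm => by
      rw [flip, (hp0 m).1 hm, flip]
    have f1 : ∀ m, part m = 1 → flip j.1 m = i.1 m := fun m hm => by
      rw [flip, (hp1 m).1 hm, flip, Fin.rev_rev]
    refine ⟨fun h => ⟨fun m hm => h ▸ f0 m hm, fun m hm => h ▸ f1 m hm⟩,
      fun h => funext fun m => (hcov m).elim (fun hm => ?_) (fun hm => ?_)⟩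
    · rw [h.1 m hm, f0 m hm]
    · rw [h.2 m hm, f1 m hm]
  have hct : c * ((t : ℤ) : ℂ) * c = ((s : ℤ) : ℂ) := by
    have ht : ((t : ℤ) : ℂ) * ((t : ℤ) : ℂ) = 1 := by
      rcases Int.units_eq_one_or t with rfl | rfl <;> simp
    linear_combination ((t : ℤ) : ℂ) * hc + ((s : ℤ) : ℂ) * ht
  rw [Fin.prod_univ_two]
  simp only [Pi.smul_apply, Pi.add_apply, smul_eq_mul, ghzVec_apply, e1, e2, e3, e4,
    cons_val_zero, cons_val_one, ite_and]
  generalize ((Real.sqrt 2 : ℝ) : ℂ)⁻¹ = r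
  rw [← hct]
  split_ifs <;> ring

lemma proj_smul_of_norm_eq_one {n : Type*} {c : ℂ} (hc : ‖c‖ = 1) (ψ : n → ℂ) :
    proj (c • ψ) = proj ψ := by
  have : c * star c = 1 := by
    rw [Complex.star_def, Complex.mul_conj, Complex.normSq_eq_norm_sq, hc]; simp
  ext x y
  simp only [proj, vecMulVec_apply, Pi.smul_apply, Pi.star_apply, smul_eq_mul, star_mul']
  linear_combination ψ x * star (ψ y) * this

/-- The parallelogram identity for projectors: an equal mixture of two vectors is also the equal
mixture of their normalised sum and difference. It trades two GHZ vectors for two product vectors.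
-/
lemma proj_add_proj_sub {n : Type*} (u v : n → ℂ) :
    proj (((Real.sqrt 2 : ℝ) : ℂ)⁻¹ • (u + v)) + proj (((Real.sqrt 2 : ℝ) : ℂ)⁻¹ • (u - v)) =
      proj u + proj v := by
  have h2 := sqrt_two_inv_mul_self
  ext x y
  simp only [proj, vecMulVec_apply, Pi.smul_apply, Pi.star_apply, smul_eq_mul, star_mul',
    Matrix.add_apply, Pi.add_apply, Pi.sub_apply, star_add, star_sub, star_inv₀]
  simp only [Complex.star_def, Complex.conj_ofReal]
  linear_combination 2 * (u x * starRingEnd ℂ (u y) + v x * starRingEnd ℂ (v y)) * h2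

lemma half_ghzVec_add_mem_mSeparable (hN : 2 ≤ N) {a b : Index N} (hab : a ≠ b) :
    (1 / 2 : ℝ) • proj (ghzVec a) + (1 / 2 : ℝ) • proj (ghzVec b) ∈ mSeparable N 2 := by
  have : NeZero N := ⟨by omega⟩
  have key : ∃ c : ℂ, ‖c‖ = 1 ∧
      IsPureMSeparable N 2 (((Real.sqrt 2 : ℝ) : ℂ)⁻¹ • (ghzVec a + c • ghzVec b)) ∧
      IsPureMSeparable N 2 (((Real.sqrt 2 : ℝ) : ℂ)⁻¹ • (ghzVec a - c • ghzVec b)) := by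
    obtain ⟨i, s⟩ := a
    obtain ⟨j, t⟩ := b
    -- For equal strings the signs are opposite, and sum and difference are computational basis
    -- vectors up to sign. For different strings, both `c` and `-c` are admissible square roots of
    -- `st`.
    by_cases hij : i = j
    · subst hij
      have ht : t = -s := by
        have : s ≠ t := fun h => hab (by rw [h])
        rcases Int.units_eq_one_or s with rfl | rfl <;>
          rcases Int.units_eq_one_or t with rfl | rfl <;> simp_all
      subst ht
      refine ⟨1, by simp, ?_, ?_⟩
      · convert isPureMSeparable_smul_single hN i.1 (c := 1) (by simp) using 1
        rw [one_smul, ghzVec, ghzVec, ← smul_add, smul_smul, sqrt_two_inv_mul_self]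
        push_cast
        module
      · convert isPureMSeparable_smul_single hN (flip i.1) (norm_intUnit s) using 1
        rw [one_smul, ghzVec, ghzVec, ← smul_sub, smul_smul, sqrt_two_inv_mul_self]
        push_cast
        change _ • (_ + _ • Pi.single (flip i.1) 1 - (_ + _ • Pi.single (flip i.1) 1)) = _
        module
    · obtain ⟨c, hc⟩ : ∃ c : ℂ, c ^ 2 = ((s : ℤ) : ℂ) * ((t : ℤ) : ℂ) :=
        IsAlgClosed.exists_pow_nat_eq _ two_pos
      refine ⟨c, ?_, isPureMSeparable_ghzVec_add hij s t hc, ?_⟩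
      · have : ‖c‖ ^ 2 = 1 := by rw [← norm_pow, hc, norm_mul, norm_intUnit, norm_intUnit, one_mul]
        exact (pow_eq_one_iff_of_nonneg (norm_nonneg _) two_ne_zero).1 this
      · rw [sub_eq_add_neg, ← neg_smul]
        exact isPureMSeparable_ghzVec_add hij s t (by rw [neg_sq, hc])
  obtain ⟨c, hc, h1, h2⟩ := key
  rw [← smul_add, ← proj_smul_of_norm_eq_one hc (ghzVec b), ← proj_add_proj_sub, smul_add]
  have hsub : ∀ {ψ}, IsPureMSeparable N 2 ψ → proj ψ ∈ mSeparable N 2 := fun {ψ} hψ =>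
    subset_convexHull ℝ {ρ | ∃ ψ, IsPureMSeparable N 2 ψ ∧ ρ = proj ψ} ⟨ψ, hψ, rfl⟩
  exact convex_convexHull ℝ _ (hsub h1) (hsub h2) (by norm_num) (by norm_num) (by norm_num)

/-! ### Distributions without a dominant weight -/

/-- Two weights strictly between 0 and 1/2 could be shifted against each other in both directions,
contradicting extremality. With at most one such weight, total mass 1 leaves only two weights equal
to 1/2 and zeros elsewhere. -/
lemma exists_pair_of_mem_extremePoints {ι : Type*} [Fintype ι] [DecidableEq ι] {p : ι → ℝ}
    (h : p ∈ Set.extremePoints ℝ {p : ι → ℝ | p ∈ stdSimplex ℝ ι ∧ ∀ b, p b ≤ 1 / 2}) :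
    ∃ a b, a ≠ b ∧ p = (1 / 2 : ℝ) • Pi.single a 1 + (1 / 2 : ℝ) • Pi.single b 1 := by
  obtain ⟨⟨⟨hp0, hp1⟩, hp2⟩, hext⟩ := h
  have hfrac : ∀ a b, a ≠ b → 0 < p a → p a < 1 / 2 → 0 < p b → p b < 1 / 2 → False := by
    intro a b hab ha0 ha1 hb0 hb1
    obtain ⟨d, hd, hda, hdb, hda', hdb'⟩ : ∃ d : ℝ, 0 < d ∧ d ≤ p a ∧ d ≤ p b ∧
        d ≤ 1 / 2 - p a ∧ d ≤ 1 / 2 - p b :=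
      ⟨min (min (p a) (p b)) (min (1 / 2 - p a) (1 / 2 - p b)), by
        simp only [lt_min_iff]; refine ⟨⟨ha0, hb0⟩, ?_, ?_⟩ <;> linarith, by simp, by simp, by simp,
        by simp⟩
    have hmem : ∀ e : ℝ, |e| ≤ d → p + (Pi.single a e - Pi.single b e) ∈
        {p : ι → ℝ | p ∈ stdSimplex ℝ ι ∧ ∀ b, p b ≤ 1 / 2} := by
      intro e he
      have he' := abs_le.1 he
      have hval : ∀ c, 0 ≤ (p + (Pi.single a e - Pi.single b e) : ι → ℝ) c ∧
          (p + (Pi.single a e - Pi.single b e) : ι → ℝ) c ≤ 1 / 2 := by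
        intro c
        by_cases hca : c = a
        · subst hca
          simp only [Pi.add_apply, Pi.sub_apply, Pi.single_eq_same, Pi.single_eq_of_ne hab]
          constructor <;> linarith
        · by_cases hcb : c = b
          · subst hcb
            simp only [Pi.add_apply, Pi.sub_apply, Pi.single_eq_same, Pi.single_eq_of_ne hca]
            constructor <;> linarith
          · simp [hca, hcb, hp0 c]
            simpa using hp2 c
      refine ⟨⟨fun c => (hval c).1, ?_⟩, fun c => (hval c).2⟩
      simp [Finset.sum_add_distrib, Finset.sum_sub_distrib, hp1]
    have := hext (hmem d (abs_of_pos hd).le) (hmem (-d) (by rw [abs_neg, abs_of_pos hd]))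
      ⟨1 / 2, 1 / 2, by norm_num, by norm_num, by norm_num, by
        funext c
        simp only [Pi.add_apply, Pi.smul_apply, Pi.sub_apply, Pi.single_neg, Pi.neg_apply,
          smul_eq_mul]
        ring⟩
    have := congrFun this a
    simp only [Pi.add_apply, Pi.sub_apply, Pi.single_eq_same, Pi.single_eq_of_ne hab] at this
    linarith
  set S : Finset ι := Finset.univ.filter fun b => p b = 1 / 2 with hS
  have hsum : (S.card : ℝ) / 2 + ∑ b ∈ Sᶜ, p b = 1 := by
    rw [← hp1, ← Finset.sum_add_sum_compl S, Finset.sum_congr (g := fun _ => (1 / 2 : ℝ)) rfl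
      fun b hb => (Finset.mem_filter.1 hb).2]
    rw [Finset.sum_const, nsmul_eq_mul]; ring
  have hlt : ∀ b ∈ Sᶜ, p b < 1 / 2 := fun b hb =>
    lt_of_le_of_ne (hp2 b) (by simpa [hS] using hb)
  have hzero : ∀ b ∈ Sᶜ, p b = 0 := by
    by_contra! hne
    obtain ⟨a, ha, ha0⟩ := hne
    have ha0' := lt_of_le_of_ne (hp0 a) (Ne.symm ha0)
    rw [Finset.sum_eq_single_of_mem a ha fun b hb hba => by
      by_contra hb0
      exact hfrac a b (Ne.symm hba) ha0' (hlt a ha) (lt_of_le_of_ne (hp0 b) (Ne.symm hb0))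
        (hlt b hb)] at hsum
    -- A single leftover weight in the open interval from 0 to 1/2 would force the number of halves
    -- to lie strictly between 1 and 2.
    have h1 := hlt a ha
    have h2 : (1 : ℝ) < S.card := by linarith
    have h3 : (S.card : ℝ) < 2 := by linarith
    norm_cast at h2 h3
    omega
  rw [Finset.sum_eq_zero hzero, add_zero] at hsum
  have hcard : S.card = 2 := by
    have : (S.card : ℝ) = 2 := by linarith
    exact_mod_cast this
  obtain ⟨a, b, hab, hSab⟩ := Finset.card_eq_two.1 hcard
  refine ⟨a, b, hab, funext fun c => ?_⟩
  by_cases hc : c ∈ S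
  · rw [(Finset.mem_filter.1 hc).2]
    rw [hSab] at hc
    rcases Finset.mem_insert.1 hc with rfl | hc
    · simp [hab]
    · rw [Finset.mem_singleton] at hc; subst hc; simp [hab.symm]
  · rw [hzero c (Finset.mem_compl.2 hc)]
    rw [hSab] at hc
    simp only [Finset.mem_insert, Finset.mem_singleton, not_or] at hc
    simp [hc.1, hc.2]

lemma mem_convexHull_pairs {ι : Type*} [Fintype ι] [DecidableEq ι] {p : ι → ℝ}
    (hp : p ∈ stdSimplex ℝ ι) (h : ∀ b, p b ≤ 1 / 2) :
    p ∈ convexHull ℝ {q : ι → ℝ | ∃ a b, a ≠ b ∧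
      q = (1 / 2 : ℝ) • Pi.single a 1 + (1 / 2 : ℝ) • Pi.single b 1} := by
  set K : Set (ι → ℝ) := {p | p ∈ stdSimplex ℝ ι ∧ ∀ b, p b ≤ 1 / 2} with hK
  have hKeq : K = stdSimplex ℝ ι ∩ ⋂ b, {p : ι → ℝ | p b ≤ 1 / 2} := by
    ext; simp [hK]
  have hcomp : IsCompact K := by
    rw [hKeq]
    exact (isCompact_stdSimplex ℝ ι).inter_right (isClosed_iInter fun b =>
      isClosed_le (continuous_apply b) continuous_const)
  have hconv : Convex ℝ K := by
    rw [hKeq]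
    refine (convex_stdSimplex ℝ ι).inter (convex_iInter fun b => ?_)
    exact convex_halfSpace_le (LinearMap.proj (R := ℝ) (φ := fun _ : ι => ℝ) b).isLinear _
  have hfin : {q : ι → ℝ | ∃ a b, a ≠ b ∧
      q = (1 / 2 : ℝ) • Pi.single a 1 + (1 / 2 : ℝ) • Pi.single b 1}.Finite := by
    refine (Set.finite_range fun ab : ι × ι => ((1 / 2 : ℝ) • Pi.single ab.1 1 +
      (1 / 2 : ℝ) • Pi.single ab.2 1 : ι → ℝ)).subset ?_
    rintro _ ⟨a, b, -, rfl⟩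
    exact ⟨(a, b), rfl⟩
  have hmem : p ∈ K := ⟨hp, h⟩
  -- Krein–Milman; the closure is harmless because the hull of finitely many points is closed.
  rw [← closure_convexHull_extremePoints hcomp hconv] at hmem
  exact closure_minimal (convexHull_mono fun q hq => exists_pair_of_mem_extremePoints hq)
    (hfin.isClosed_convexHull ℝ) hmem

lemma ghzDiag_mem_mSeparable (hN : 2 ≤ N) {p : Index N → ℝ} (hp : p ∈ stdSimplex ℝ (Index N))
    (h : ∀ b, p b ≤ 1 / 2) : ghzDiag p ∈ mSeparable N 2 := by
  have hconv : Convex ℝ {q : Index N → ℝ | ghzDiag q ∈ mSeparable N 2} := by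
    intro q hq q' hq' a b ha hb hab
    rw [Set.mem_ofPred_eq, ghzDiag_add, ghzDiag_smul, ghzDiag_smul]
    exact convex_convexHull ℝ _ hq hq' ha hb hab
  refine convexHull_min ?_ hconv (mem_convexHull_pairs hp h)
  rintro _ ⟨a, b, hab, rfl⟩
  rw [Set.mem_ofPred_eq, ghzDiag_add, ghzDiag_smul, ghzDiag_smul, ghzDiag_single, ghzDiag_single]
  exact half_ghzVec_add_mem_mSeparable hN hab

lemma ghzDiag_mem_mSeparable_iff (hN : 2 ≤ N) {p : Index N → ℝ} (hp : p ∈ stdSimplex ℝ (Index N))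
    {b₀ : Index N} (hb : ∀ b, p b ≤ p b₀) : ghzDiag p ∈ mSeparable N 2 ↔ p b₀ ≤ 1 / 2 := by
  have : NeZero N := ⟨by omega⟩
  refine ⟨fun h => ?_, fun h => ghzDiag_mem_mSeparable hN hp fun b => (hb b).trans h⟩
  rw [← expVal_ghzDiag p b₀]
  exact expVal_ghzVec_le_of_mem_mSeparable h b₀

end Separable

/-! ### GHZ-diagonalisation by local unitaries -/

section Twirl

variable {n : ℕ}

/-- The single-qubit operator `σ₁^a · diag(1, t)`. -/
def flipPhase (a : Bool) (t : ℤˣ) : Matrix (Fin 2) (Fin 2) ℂ :=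
  Matrix.of fun i j => if j = (if a then Fin.rev i else i) then
    (if j = 0 then 1 else ((t : ℤ) : ℂ)) else 0

lemma flipPhase_mem_unitaryGroup (a : Bool) (t : ℤˣ) :
    flipPhase a t ∈ unitaryGroup (Fin 2) ℂ := by
  rw [mem_unitaryGroup_iff]
  ext i j
  rcases Int.units_eq_one_or t with rfl | rfl <;> cases a <;> fin_cases i <;> fin_cases j <;>
    simp [flipPhase, Matrix.mul_apply, Matrix.star_apply]

/-- The local unitaries `(σ₁^a)^{⊗(n+1)} · ⨂ₖ diag(1, sₖ sₖ₊₁)`, which are stabilisers of the GHZ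
basis up to signs. -/
def twirlUnitary (a : Bool) (s : Fin (n + 1) → ℤˣ) (k : Fin (n + 1)) : Matrix (Fin 2) (Fin 2) ℂ :=
  flipPhase a (s k * s (k + 1))

/-- The sign with which `⨂ₖ diag(1, sₖ sₖ₊₁)` acts on `|x⟩`. -/
def twirlSign (s : Fin (n + 1) → ℤˣ) (x : Bits (n + 1)) : ℂ :=
  ∏ k, if x k = 0 then 1 else (((s k * s (k + 1) : ℤˣ) : ℤ) : ℂ)

lemma localOp_twirlUnitary (a : Bool) (s : Fin (n + 1) → ℤˣ) (x y : Bits (n + 1)) :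
    localOp (twirlUnitary a s) x y =
      if y = (if a then flip x else x) then twirlSign s y else 0 := by
  simp only [localOp, twirlUnitary, flipPhase, Matrix.of_apply]
  rw [Finset.prod_ite_zero]
  have h : (∀ k ∈ Finset.univ, y k = if a then Fin.rev (x k) else x k) ↔
      y = if a then flip x else x := by
    rw [funext_iff]
    cases a <;> simp [flip]
  by_cases hy : y = if a then flip x else x
  · rw [if_pos hy, if_pos (h.2 hy), twirlSign]
  · rw [if_neg hy, if_neg (mt h.1 hy)]

lemma star_twirlSign (s : Fin (n + 1) → ℤˣ) (x : Bits (n + 1)) :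
    star (twirlSign s x) = twirlSign s x := by
  rw [twirlSign, Complex.star_def, map_prod]
  refine Finset.prod_congr rfl fun k _ => ?_
  split_ifs <;> simp

lemma localConj_twirlUnitary (a : Bool) (s : Fin (n + 1) → ℤˣ) (ρ : QOp (n + 1))
    (x y : Bits (n + 1)) :
    localConj (twirlUnitary a s) ρ x y =
      twirlSign s (if a then flip x else x) * twirlSign s (if a then flip y else y) *
        ρ (if a then flip x else x) (if a then flip y else y) := by
  simp only [localConj, Matrix.mul_apply, conjTranspose_apply, localOp_twirlUnitary, ite_mul,
    zero_mul, apply_ite star, star_zero, mul_ite, mul_zero, Finset.sum_ite_eq', Finset.mem_univ,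
    if_true, star_twirlSign]
  ring

/-- Character orthogonality. The phases `sₖ sₖ₊₁`, taken cyclically, have product 1, so a string and
its flip receive the same sign, while any two strings not related in this way are separated by some
choice of `s`. -/
lemma sum_twirlSign (x y : Bits (n + 1)) :
    ∑ s : Fin (n + 1) → ℤˣ, twirlSign s x * twirlSign s y =
      if leader x = leader y then 2 ^ (n + 1) else 0 := by
  set e : Fin (n + 1) → ℤˣ → ℂ := fun k u => if x k = y k then 1 else ((u : ℤ) : ℂ) with he
  have h1 : ∀ s : Fin (n + 1) → ℤˣ,
      twirlSign s x * twirlSign s y = ∏ k, e (k + 1) (s (k + 1)) * e k (s (k + 1)) := by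
    intro s
    -- Each sign occurs in two neighbouring factors. A cyclic shift collects both occurrences of `s
    -- (k + 1)`, so that the sum over `s` factorises.
    have h2 : ∏ k, e (k + 1) (s (k + 1)) = ∏ k, e k (s k) :=
      Equiv.prod_comp (Equiv.addRight (1 : Fin (n + 1))) fun k => e k (s k)
    rw [Finset.prod_mul_distrib, h2, ← Finset.prod_mul_distrib, twirlSign, twirlSign,
      ← Finset.prod_mul_distrib]
    refine Finset.prod_congr rfl fun k _ => ?_
    simp only [he]
    generalize x k = c, y k = d, s k = u, s (k + 1) = v
    rcases Int.units_eq_one_or u with rfl | rfl <;> rcases Int.units_eq_one_or v with rfl | rfl <;>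
      fin_cases c <;> fin_cases d <;> simp
  have h3 : ∑ s : Fin (n + 1) → ℤˣ, twirlSign s x * twirlSign s y =
      ∏ k, ∑ u, e (k + 1) u * e k u := by
    rw [Finset.prod_univ_sum, Fintype.piFinset_univ]
    simp only [h1]
    exact (Equiv.arrowCongr (Equiv.addRight (1 : Fin (n + 1))).symm (Equiv.refl ℤˣ)).sum_comp
      fun s => ∏ k, e (k + 1) (s k) * e k (s k)
  have h4 : ∀ k, ∑ u, e (k + 1) u * e k u =
      if (x (k + 1) = y (k + 1) ↔ x k = y k) then 2 else 0 := by
    intro k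
    rw [sum_units_int]
    simp only [he]
    by_cases ha : x (k + 1) = y (k + 1) <;> by_cases hb : x k = y k <;> simp [ha, hb] <;> norm_num
  rw [h3]
  simp only [h4]
  rw [Finset.prod_ite_zero]
  -- If agreement of the bits never changes between neighbours, the strings agree everywhere or
  -- nowhere.
  have h5 : (∀ k, (x (k + 1) = y (k + 1) ↔ x k = y k)) ↔ leader x = leader y := by
    constructor
    · intro h
      have h6 : ∀ k, (x k = y k ↔ x 0 = y 0) := by
        intro k
        induction k using Fin.induction with
        | zero => rfl
        | succ k ih => rw [← Fin.coeSucc_eq_succ, h, ih]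
      by_cases h0 : x 0 = y 0
      · rw [show x = y from funext fun k => (h6 k).2 h0]
      · have : x = flip y := funext fun k =>
          (eq_or_eq_rev (x k) (y k)).resolve_left fun hk => h0 ((h6 k).1 hk)
        rw [this]
        rcases leader_cases y with hy | hy <;> generalize leader y = j at hy <;> subst hy
        · rw [leader_flip_val]
        · rw [flip_flip, leader_val]
    · intro h
      have hxy : x = y ∨ x = flip y := by
        have hx := leader_cases x
        have hy := leader_cases y
        rw [h] at hx
        generalize leader y = j at hx hy
        rcases hx with rfl | rfl <;> rcases hy with rfl | rfl <;> simp
      rcases hxy with rfl | rfl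
      · simp
      · intro k; simp [flip_apply_ne]
  simp [h5]

lemma overlap_coe {N : ℕ} [NeZero N] {ρ : QOp N} (h : IsState ρ)
    (i : {i : Bits N // ∀ k : Fin N, (k : ℕ) = 0 → i k = 0}) (s : ℤˣ) :
    (overlap ρ (i, s) : ℂ) = 1 / 2 * (ρ i.1 i.1 + ρ (flip i.1) (flip i.1) +
      ((s : ℤ) : ℂ) * (ρ i.1 (flip i.1) + ρ (flip i.1) i.1)) := by
  have hs : ((s : ℤ) : ℂ) * ((s : ℤ) : ℂ) = 1 := by
    rcases Int.units_eq_one_or s with rfl | rfl <;> simp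
  have h2 := sqrt_two_inv_mul_self
  refine (h.expVal_coe (ghzVec (i, s))).trans ?_
  rw [star_ghzVec, ghzVec]
  change (_ • (_ + _ • Pi.single (flip i.1) 1)) ⬝ᵥ (ρ *ᵥ (_ • (_ + _ • Pi.single (flip i.1) 1))) = _
  simp only [smul_dotProduct, add_dotProduct, mulVec_smul, mulVec_add, mulVec_single_one,
    single_one_dotProduct, Pi.smul_apply, Pi.add_apply, smul_eq_mul, col_apply]
  linear_combination (ρ i.1 i.1 + ((s : ℤ) : ℂ) * ((s : ℤ) : ℂ) * ρ (flip i.1) (flip i.1) +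
    ((s : ℤ) : ℂ) * (ρ i.1 (flip i.1) + ρ (flip i.1) i.1)) * h2 +
    1 / 2 * ρ (flip i.1) (flip i.1) * hs

lemma ghzDiag_overlap_apply {N : ℕ} [NeZero N] {ρ : QOp N} (h : IsState ρ) (x y : Bits N) :
    ghzDiag (overlap ρ) x y =
      if leader x = leader y then 1 / 2 * (ρ x y + ρ (flip x) (flip y)) else 0 := by
  rw [ghzDiag_apply]
  split_ifs with h1 h2
  · subst h2
    rw [overlap_coe h, overlap_coe h]
    rcases leader_cases x with hx | hx <;> generalize leader x = j at hx <;> subst hx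
    · push_cast; ring
    · rw [flip_flip]; push_cast; ring
  · have hx := leader_cases x
    have hy := leader_cases y
    rw [overlap_coe h, overlap_coe h]
    rw [← h1] at hy
    generalize leader x = j at hx hy
    rcases hx with rfl | rfl <;> rcases hy with rfl | rfl
    · exact absurd rfl h2
    · rw [flip_flip]; push_cast; ring
    · rw [flip_flip]; push_cast; ring
    · exact absurd rfl h2
  · rfl

/-- Averaging over the phases removes all entries outside the planes spanned by a string and its
flip; averaging over the global flip then makes each remaining block GHZ-diagonal. The normalisation
counts `2 ^ (n + 1)` sign choices times two flips. -/
lemma sum_localConj_twirlUnitary {ρ : QOp (n + 1)} (h : IsState ρ) :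
    ∑ j : Bool × (Fin (n + 1) → ℤˣ), ((2 ^ (n + 2) : ℝ)⁻¹) • localConj (twirlUnitary j.1 j.2) ρ =
      ghzDiag (overlap ρ) := by
  ext x y
  rw [ghzDiag_overlap_apply h, Matrix.sum_apply, Fintype.sum_prod_type]
  simp only [Matrix.smul_apply, localConj_twirlUnitary, Fintype.sum_bool, if_true,
    Bool.false_eq_true, if_false]
  rw [← Finset.smul_sum, ← Finset.smul_sum, ← Finset.sum_mul, ← Finset.sum_mul, sum_twirlSign,
    sum_twirlSign]
  have hl : ∀ z : Bits (n + 1), leader (flip z) = leader z := fun z => by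
    rcases leader_cases z with hz | hz <;> generalize leader z = j at hz <;> subst hz
    · exact leader_flip_val _
    · rw [flip_flip, leader_val]
  rw [hl, hl]
  split_ifs
  · simp only [Complex.real_smul]
    push_cast
    field_simp
    ring
  · simp

lemma exists_ghzDiagonalisation {N : ℕ} (hN : 2 ≤ N) :
    ∃ (K : ℕ) (w : Fin K → ℝ) (U : Fin K → Fin N → Matrix (Fin 2) (Fin 2) ℂ),
      w ∈ stdSimplex ℝ (Fin K) ∧ (∀ j k, U j k ∈ unitaryGroup (Fin 2) ℂ) ∧
      ∀ ρ : QOp N, IsState ρ → overlap ρ ∈ stdSimplex ℝ (Index N) ∧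
        ∑ j, w j • localConj (U j) ρ = ghzDiag (overlap ρ) := by
  obtain ⟨n, rfl⟩ : ∃ n, N = n + 1 := ⟨N - 1, by omega⟩
  set e := Fintype.equivFin (Bool × (Fin (n + 1) → ℤˣ)) with he
  refine ⟨_, fun _ => (2 ^ (n + 2) : ℝ)⁻¹, fun j => twirlUnitary (e.symm j).1 (e.symm j).2,
    ⟨fun _ => by positivity, ?_⟩, fun j k => flipPhase_mem_unitaryGroup _ _,
    fun ρ hρ => ⟨overlap_mem_stdSimplex hρ, ?_⟩⟩
  · have hc : Fintype.card ℤˣ = 2 := rfl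
    simp [hc]
    field_simp
    ring
  · rw [← sum_localConj_twirlUnitary hρ]
    exact e.symm.sum_comp fun j => ((2 ^ (n + 2) : ℝ)⁻¹) • localConj (twirlUnitary j.1 j.2) ρ

end Twirl

/-! ### Reduction of the law to a two-outcome inequality -/

section Reduction

variable {N : ℕ}

lemma exists_index_ne (b : Index N) : ∃ b', b' ≠ b :=
  ⟨(b.1, -b.2), fun h => by
    have : -b.2 = b.2 := congrArg Prod.snd h
    rcases Int.units_eq_one_or b.2 with hb | hb <;> rw [hb] at this <;> exact absurd this (by decide)⟩

lemma nonempty_index : Nonempty (Index N) := ⟨(⟨fun _ => 0, fun _ _ => rfl⟩, 1)⟩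

lemma mix_mem_stdSimplex {ι : Type*} [Fintype ι] [DecidableEq ι] (b₀ : ι) {r : ι → ℝ}
    (hr : r ∈ stdSimplex ℝ ι) {P : ℝ} (h0 : 0 ≤ P) (h1 : P ≤ 1) :
    P • Pi.single b₀ 1 + (1 - P) • r ∈ stdSimplex ℝ ι :=
  convex_stdSimplex ℝ ι (single_mem_stdSimplex ℝ b₀) hr h0 (by linarith) (by ring)

/-- Splitting off one of the weights of a distribution. -/
lemma exists_mix_eq {ι : Type*} [Fintype ι] [DecidableEq ι] {p : ι → ℝ}
    (hp : p ∈ stdSimplex ℝ ι) (b₀ : ι) (hb₀ : ∃ b, b ≠ b₀) :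
    ∃ r ∈ stdSimplex ℝ ι, r b₀ = 0 ∧ p = p b₀ • Pi.single b₀ 1 + (1 - p b₀) • r := by
  obtain ⟨hp0, hp1⟩ := hp
  have hsum : p b₀ + ∑ b ∈ {b₀}ᶜ, p b = 1 := by
    rw [← hp1, ← Finset.sum_add_sum_compl {b₀}, Finset.sum_singleton]
  by_cases h1 : p b₀ = 1
  -- No weight is left to rescale, so the residual distribution is arbitrary; a point mass off `b₀`
  -- is taken.
  · obtain ⟨b₁, hb₁⟩ := hb₀
    refine ⟨Pi.single b₁ 1, single_mem_stdSimplex ℝ b₁, by simp [hb₁.symm], ?_⟩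
    have hz : ∀ b ∈ ({b₀}ᶜ : Finset ι), p b = 0 :=
      (Finset.sum_eq_zero_iff_of_nonneg fun b _ => hp0 b).1 (by linarith)
    funext b
    by_cases hb : b = b₀
    · subst hb; simp [h1]
    · rw [hz b (by simpa using hb)]; simp [h1, hb]
  · have h2 : 1 - p b₀ ≠ 0 := sub_ne_zero.2 (Ne.symm h1)
    have h3 : 0 ≤ 1 - p b₀ := by
      have := Finset.sum_nonneg fun b (_ : b ∈ ({b₀}ᶜ : Finset ι)) => hp0 b
      linarith
    refine ⟨fun b => if b = b₀ then 0 else p b / (1 - p b₀), ⟨fun b => ?_, ?_⟩, by simp, ?_⟩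
    · dsimp only
      split_ifs
      · exact le_rfl
      · exact div_nonneg (hp0 b) h3
    · rw [← Finset.sum_add_sum_compl {b₀}, Finset.sum_singleton, if_pos rfl, zero_add,
        Finset.sum_congr (g := fun b => p b / (1 - p b₀)) rfl
          fun b hb => if_neg (by simpa using hb), ← Finset.sum_div, div_eq_one_iff_eq h2]
      linarith
    · funext b
      by_cases hb : b = b₀
      · subst hb; simp
      · simp [hb, mul_div_cancel₀ _ h2]

lemma stdSimplex_apply_le_one {ι : Type*} [Fintype ι] {p : ι → ℝ} (hp : p ∈ stdSimplex ℝ ι)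
    (b : ι) : p b ≤ 1 := by
  rw [← hp.2]
  exact Finset.single_le_sum (fun b _ => hp.1 b) (Finset.mem_univ b)

lemma isState_localConj {ρ : QOp N} (hρ : IsState ρ) {U : Fin N → Matrix (Fin 2) (Fin 2) ℂ}
    (hU : ∀ k, U k ∈ unitaryGroup (Fin 2) ℂ) : IsState (localConj U ρ) := by
  refine ⟨hρ.1.mul_mul_conjTranspose_same _, ?_⟩
  rw [localConj, trace_mul_comm, ← Matrix.mul_assoc,
    show (localOp U)ᴴ * localOp U = 1 from tensorOp_conjTranspose_mul_self hU, one_mul, hρ.2]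

/-- The law holds for `D` and `g` as soon as `g` bounds `D` from below for two states on opposite
sides of `1/2` with respect to some unit vector, and the bound is attained by the GHZ-diagonal
states obtained by changing the largest eigenvalue to `1/2` and rescaling the others. -/
theorem genuineLaw_of_bound (hN : 2 ≤ N) {D : QOp N → QOp N → ℝ≥0∞} {g : ℝ → ℝ≥0∞}
    (hself : ∀ p ∈ stdSimplex ℝ (Index N), D (ghzDiag p) (ghzDiag p) = 0)
    (hlow : ∀ ψ, star ψ ⬝ᵥ ψ = 1 → ∀ ρ σ, IsState ρ → IsState σ → 1 / 2 < expVal ψ ρ →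
      expVal ψ σ ≤ 1 / 2 → g (expVal ψ ρ) ≤ D ρ σ)
    (hattain : ∀ (b₀ : Index N), ∀ r ∈ stdSimplex ℝ (Index N), r b₀ = 0 → ∀ P : ℝ, 1 / 2 < P →
      P ≤ 1 → D (ghzDiag (P • Pi.single b₀ 1 + (1 - P) • r))
        (ghzDiag ((1 / 2 : ℝ) • Pi.single b₀ 1 + (1 - 1 / 2 : ℝ) • r)) = g P)
    (hmono : MonotoneOn g (Set.Ioc (1 / 2) 1))
    (hstrict : IsFaithful D → ∀ p p' : ℝ, 1 / 2 < p → p < p' → p' ≤ 1 → g p ≠ ⊤ → g p < g p') :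
    GenuineLaw N D g := by
  have : NeZero N := ⟨by omega⟩
  have hclosest : ∀ p ∈ stdSimplex ℝ (Index N), ∀ b₀, 1 / 2 < p b₀ →
      ∃ q ∈ stdSimplex ℝ (Index N), q b₀ = 1 / 2 ∧ ghzDiag q ∈ mSeparable N 2 ∧
        D (ghzDiag p) (ghzDiag q) = g (p b₀) ∧
        ∀ ς ∈ mSeparable N 2, g (p b₀) ≤ D (ghzDiag p) ς := by
    intro p hp b₀ hb₀
    obtain ⟨r, hr, hr0, hpr⟩ := exists_mix_eq hp b₀ (exists_index_ne b₀)
    have hq := mix_mem_stdSimplex b₀ hr (P := 1 / 2) (by norm_num) (by norm_num)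
    have hq0 : ((1 / 2 : ℝ) • Pi.single b₀ 1 + (1 - 1 / 2 : ℝ) • r : Index N → ℝ) b₀ = 1 / 2 := by
      simp [hr0]
    refine ⟨_, hq, hq0, ghzDiag_mem_mSeparable hN hq fun b => ?_, ?_, fun ς hς => ?_⟩
    · by_cases hb : b = b₀
      · rw [hb, hq0]
      · have := stdSimplex_apply_le_one hr b
        simp [hb]
        linarith
    · have := hattain b₀ r hr hr0 (p b₀) hb₀ (stdSimplex_apply_le_one hp b₀)
      rwa [← hpr] at this
    · have := hlow (ghzVec b₀) (ghzVec_unit b₀) (ghzDiag p) ς (isState_ghzDiag hp)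
        (mSeparable_subset_isState hς)
      rw [expVal_ghzDiag] at this
      exact this hb₀ (expVal_ghzVec_le_of_mem_mSeparable hς b₀)
  have hzero : ∀ p ∈ stdSimplex ℝ (Index N), ∀ b₀, (∀ b, p b ≤ p b₀) → p b₀ ≤ 1 / 2 →
      entanglement 2 D (ghzDiag p) = 0 := by
    intro p hp b₀ hb h
    refine le_antisymm ?_ bot_le
    refine (iInf₂_le _ ((ghzDiag_mem_mSeparable_iff hN hp hb).2 h)).trans_eq ?_
    exact hself p hp
  have heq : ∀ p ∈ stdSimplex ℝ (Index N), ∀ b₀, 1 / 2 < p b₀ →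
      entanglement 2 D (ghzDiag p) = g (p b₀) := by
    intro p hp b₀ h
    obtain ⟨q, -, -, hq, hDq, hle⟩ := hclosest p hp b₀ h
    exact le_antisymm ((iInf₂_le _ hq).trans_eq hDq) (le_iInf₂ hle)
  have hbound : ∀ ρ : QOp N, IsState ρ → ∀ U : Fin N → Matrix (Fin 2) (Fin 2) ℂ,
      (∀ k, U k ∈ Matrix.unitaryGroup (Fin 2) ℂ) → ∀ b, 1 / 2 < overlap (localConj U ρ) b →
      g (overlap (localConj U ρ) b) ≤ entanglement 2 D ρ := by
    intro ρ hρ U hU b hb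
    refine le_iInf₂ fun ς hς => ?_
    have h2 := overlap_localConj_le_of_mem_mSeparable hς hU b
    -- The unitary is moved from the state to the GHZ vector, so the bound for an arbitrary unit
    -- vector applies to `ρ` and `ς` themselves.
    rw [overlap_localConj] at hb h2 ⊢
    refine hlow _ (unit_mulVec ?_ (ghzVec_unit b)) ρ ς hρ (mSeparable_subset_isState hς) hb h2
    rw [conjTranspose_conjTranspose]
    exact tensorOp_mul_conjTranspose_self hU
  refine ⟨fun p hp b₀ hb h => ?_, hzero, fun p hp b₀ _ h => heq p hp b₀ h, hmono, hstrict,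
    fun ρ hρ U hU => ?_, hbound⟩
  · rw [ghzDiag_mem_mSeparable_iff hN hp hb, not_le] at h
    obtain ⟨q, hq, hq0, hqs, hDq, hle⟩ := hclosest p hp b₀ h
    exact ⟨q, hq, hq0, hqs, fun ς hς => hDq.le.trans (hle ς hς)⟩
  · have := nonempty_index (N := N)
    have hs := overlap_mem_stdSimplex (isState_localConj hρ hU)
    -- Only the largest overlap matters: above 1/2 it fixes the value for the diagonalised state,
    -- and that value is exactly the bound already known for `ρ`. The twirling channel is not needed
    -- here.
    obtain ⟨b₀, hb₀⟩ := Finite.exists_max (overlap (localConj U ρ))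
    rcases le_or_gt (overlap (localConj U ρ) b₀) (1 / 2) with h | h
    · rw [hzero _ hs b₀ hb₀ h]; exact bot_le
    · rw [heq _ hs b₀ h]; exact hbound ρ hρ U hU b₀ h

end Reduction

/-! ### Two-outcome measure-and-prepare channels -/

section Channel

variable {m n : Type*} [Fintype m]

/-- Complete positivity of `X ↦ Tr(EX)`: writing `E = F†F` gives the Kraus form with operators `id ⊗
⟨l|F`. -/
lemma posSemidef_trace_mul_blocks {k : ℕ} {E : Matrix m m ℂ} (hE : E.PosSemidef)
    {X : Matrix (Fin k × m) (Fin k × m) ℂ} (hX : X.PosSemidef) :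
    (Matrix.of fun a b : Fin k =>
      (E * Matrix.of fun i j => X (a, i) (b, j)).trace).PosSemidef := by
  obtain ⟨F, rfl⟩ := exists_eq_conjTranspose_mul_self hE
  set B : m → Matrix (Fin k) (Fin k × m) ℂ := fun l =>
    Matrix.of fun a c => if a = c.1 then F l c.2 else 0 with hB
  have : (Matrix.of fun a b : Fin k => (Fᴴ * F * Matrix.of fun i j => X (a, i) (b, j)).trace) =
      ∑ l, B l * X * (B l)ᴴ := by
    ext a b
    rw [Matrix.of_apply, Matrix.mul_assoc, trace_mul_comm, Matrix.sum_apply]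
    simp only [trace, diag_apply]
    refine Finset.sum_congr rfl fun l _ => ?_
    simp only [Matrix.mul_apply, hB, Matrix.of_apply, conjTranspose_apply,
      Fintype.sum_prod_type, apply_ite star, star_zero, ite_mul, zero_mul, mul_ite, mul_zero,
      Finset.sum_ite_irrel, Finset.sum_const_zero, Finset.sum_ite_eq, Finset.mem_univ, if_true]
  rw [this]
  exact posSemidef_sum _ fun l _ => hX.mul_mul_conjTranspose_same (B l)

variable [DecidableEq m]

/-- The map that measures the effect `E` and prepares `τ₀` or `τ₁` according to the outcome. -/
def measurePrepare (E : Matrix m m ℂ) (τ₀ τ₁ : Matrix n n ℂ) : Matrix m m ℂ →ₗ[ℂ] Matrix n n ℂ :=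
  (traceLinearMap m ℂ ℂ ∘ₗ LinearMap.mulLeft ℂ E).smulRight τ₀ +
    (traceLinearMap m ℂ ℂ ∘ₗ LinearMap.mulLeft ℂ (1 - E)).smulRight τ₁

lemma measurePrepare_apply (E X : Matrix m m ℂ) (τ₀ τ₁ : Matrix n n ℂ) :
    measurePrepare E τ₀ τ₁ X = (E * X).trace • τ₀ + ((1 - E) * X).trace • τ₁ := rfl

lemma isChannel_measurePrepare [Fintype n] {E : Matrix m m ℂ} (hE : E.PosSemidef) (hE' : (1 - E).PosSemidef)
    {τ₀ τ₁ : Matrix n n ℂ} (h₀ : IsState τ₀) (h₁ : IsState τ₁) :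
    IsChannel (measurePrepare E τ₀ τ₁) := by
  refine ⟨fun k X hX => ?_, fun X => ?_⟩
  -- The ampliation is by definition a sum of two Kronecker products, of the matrix of outcome
  -- traces with the prepared state.
  · exact ((posSemidef_trace_mul_blocks hE hX).kronecker h₀.1).add
      ((posSemidef_trace_mul_blocks hE' hX).kronecker h₁.1)
  · rw [measurePrepare_apply, trace_add, trace_smul, trace_smul, h₀.2, h₁.2, sub_mul, one_mul,
      trace_sub]
    simp

lemma measurePrepare_state {E : Matrix m m ℂ} (hE : E.PosSemidef) (τ₀ τ₁ : Matrix n n ℂ)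
    {ρ : Matrix m m ℂ} (hρ : IsState ρ) :
    measurePrepare E τ₀ τ₁ ρ = (E * ρ).trace.re • τ₀ + (1 - (E * ρ).trace.re) • τ₁ := by
  have h : (E * ρ).trace = ((E * ρ).trace.re : ℂ) :=
    Complex.ext rfl (Complex.le_def.1 (trace_mul_nonneg hE hρ.1)).2.symm
  rw [measurePrepare_apply, sub_mul, one_mul, trace_sub, hρ.2]
  nth_rw 1 2 [h]
  rw [← Complex.coe_smul, ← Complex.coe_smul]
  push_cast
  rfl

end Channel

/-! ### Contractive convex distances -/

section Contractive

variable {N N' : ℕ}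

/-- The mixture of two GHZ basis states with weights `P` and `1 - P`. -/
def ghzMix (c₀ c₁ : Index N) (P : ℝ) : QOp N :=
  P • proj (ghzVec c₀) + (1 - P) • proj (ghzVec c₁)

variable [NeZero N']

lemma isState_proj_ghzVec (b : Index N') : IsState (proj (ghzVec b)) := isState_proj (ghzVec_unit b)

lemma isState_ghzMix (c₀ c₁ : Index N') {P : ℝ} (h0 : 0 ≤ P) (h1 : P ≤ 1) :
    IsState (ghzMix c₀ c₁ P) :=
  convex_isState (isState_proj_ghzVec c₀) (isState_proj_ghzVec c₁) h0 (by linarith) (by ring)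

lemma expVal_ghzMix {c₀ c₁ : Index N'} (hc : c₀ ≠ c₁) (P : ℝ) :
    expVal (ghzVec c₀) (ghzMix c₀ c₁ P) = P := by
  rw [ghzMix, expVal_add, expVal_smul, expVal_smul, expVal_proj, expVal_proj,
    star_ghzVec_dotProduct, star_ghzVec_dotProduct, if_pos rfl, if_neg hc]
  simp

lemma IsContractiveConvex.ghzMix_le {D : QOp N' → QOp N' → ℝ≥0∞} (hD : IsContractiveConvex D)
    (c₀ c₁ : Index N') {P q : ℝ} (hP : 1 / 2 < P) (hP1 : P ≤ 1) (hq0 : 0 ≤ q) (hq : q ≤ 1 / 2) :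
    D (ghzMix c₀ c₁ P) (ghzMix c₀ c₁ (1 / 2)) ≤
      ENNReal.ofReal ((P - 1 / 2) / (P - q)) * D (ghzMix c₀ c₁ P) (ghzMix c₀ c₁ q) := by
  have hpos : 0 < P - q := by linarith
  have hPs := isState_ghzMix c₀ c₁ (P := P) (by linarith) hP1
  have hqs := isState_ghzMix c₀ c₁ hq0 (by linarith)
  -- The weight places 1/2 between `P` and `q`. The endpoint `P` contributes distance zero, which
  -- leaves only the factor in front of the other endpoint.
  have h := hD.convex _ _ _ hPs hPs hqs ((1 / 2 - q) / (P - q))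
    (div_nonneg (by linarith) hpos.le) (by rw [div_le_one hpos]; linarith)
  have e1 : 1 - (1 / 2 - q) / (P - q) = (P - 1 / 2) / (P - q) := by field_simp; ring
  have e2 : ((1 / 2 - q) / (P - q)) • ghzMix c₀ c₁ P +
      ((P - 1 / 2) / (P - q)) • ghzMix c₀ c₁ q = ghzMix c₀ c₁ (1 / 2) := by
    have e3 : (1 / 2 - q) / (P - q) * P + (P - 1 / 2) / (P - q) * q = 1 / 2 := by
      field_simp; ring
    have e4 : (1 / 2 - q) / (P - q) * (1 - P) + (P - 1 / 2) / (P - q) * (1 - q) = 1 - 1 / 2 := by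
      field_simp; ring
    simp only [ghzMix, smul_add, smul_smul]
    rw [add_add_add_comm, ← add_smul, ← add_smul, e3, e4]
  rw [e1, e2, hD.self _ hPs, mul_zero, zero_add] at h
  exact h

lemma one_sub_proj_posSemidef {N : ℕ} {ψ : Bits N → ℂ} (hψ : star ψ ⬝ᵥ ψ = 1) :
    (1 - proj ψ).PosSemidef :=
  one_sub_posSemidef_of_idempotent (proj_isHermitian ψ) (proj_mul_self hψ)

/-- A contractive convex distance `D` obeys the law, with `g` computed from two orthogonal pure
states of any reference system with which `D` is compatible. -/
theorem genuineLaw_of_contractive (hN : 2 ≤ N) {D : QOp N → QOp N → ℝ≥0∞}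
    {D' : QOp N' → QOp N' → ℝ≥0∞} (hD : IsContractiveConvex D) (hD' : IsContractiveConvex D')
    (hto : ∀ Φ : QOp N →ₗ[ℂ] QOp N', IsChannel Φ →
      ∀ ρ σ, IsState ρ → IsState σ → D' (Φ ρ) (Φ σ) ≤ D ρ σ)
    (hfrom : ∀ Φ : QOp N' →ₗ[ℂ] QOp N, IsChannel Φ →
      ∀ ρ σ, IsState ρ → IsState σ → D (Φ ρ) (Φ σ) ≤ D' ρ σ)
    {c₀ c₁ : Index N'} (hc : c₀ ≠ c₁) :
    GenuineLaw N D fun P => D' (ghzMix c₀ c₁ P) (ghzMix c₀ c₁ (1 / 2)) := by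
  have : NeZero N := ⟨by omega⟩
  have hmeas : ∀ ψ : Bits N → ℂ, star ψ ⬝ᵥ ψ = 1 → ∀ ρ σ, IsState ρ → IsState σ →
      D' (ghzMix c₀ c₁ (expVal ψ ρ)) (ghzMix c₀ c₁ (expVal ψ σ)) ≤ D ρ σ := by
    intro ψ hψ ρ σ hρ hσ
    have h := hto _ (isChannel_measurePrepare (proj_posSemidef ψ)
      (one_sub_proj_posSemidef hψ) (isState_proj_ghzVec c₀) (isState_proj_ghzVec c₁))
      ρ σ hρ hσ
    rwa [measurePrepare_state (proj_posSemidef ψ) _ _ hρ,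
      measurePrepare_state (proj_posSemidef ψ) _ _ hσ, ← expVal_eq_trace, ← expVal_eq_trace] at h
  have hattain : ∀ (b₀ : Index N), ∀ r ∈ stdSimplex ℝ (Index N), r b₀ = 0 → ∀ P : ℝ, 1 / 2 < P →
      P ≤ 1 → D (ghzDiag (P • Pi.single b₀ 1 + (1 - P) • r))
        (ghzDiag ((1 / 2 : ℝ) • Pi.single b₀ 1 + (1 - 1 / 2 : ℝ) • r)) =
        D' (ghzMix c₀ c₁ P) (ghzMix c₀ c₁ (1 / 2)) := by
    intro b₀ r hr hr0 P hP hP1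
    apply le_antisymm
    -- One channel rebuilds both states because they share the residual distribution `r`; this is
    -- why the other eigenvalues are rescaled proportionally.
    · have h := hfrom _ (isChannel_measurePrepare (proj_posSemidef (ghzVec c₀))
        (one_sub_proj_posSemidef (ghzVec_unit c₀)) (isState_proj_ghzVec b₀)
        (isState_ghzDiag hr)) _ _ (isState_ghzMix c₀ c₁ (P := P) (by linarith) hP1)
        (isState_ghzMix c₀ c₁ (P := 1 / 2) (by norm_num) (by norm_num))
      rw [measurePrepare_state (proj_posSemidef _) _ _ (isState_ghzMix c₀ c₁ (by linarith) hP1),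
        measurePrepare_state (proj_posSemidef _) _ _
          (isState_ghzMix c₀ c₁ (by norm_num) (by norm_num)),
        ← expVal_eq_trace, ← expVal_eq_trace, expVal_ghzMix hc, expVal_ghzMix hc] at h
      rwa [ghzDiag_add, ghzDiag_smul, ghzDiag_smul, ghzDiag_single, ghzDiag_add, ghzDiag_smul,
        ghzDiag_smul, ghzDiag_single]
    · have h := hmeas (ghzVec b₀) (ghzVec_unit b₀) _ _
        (isState_ghzDiag (mix_mem_stdSimplex b₀ hr (P := P) (by linarith) hP1))
        (isState_ghzDiag (mix_mem_stdSimplex b₀ hr (P := 1 / 2) (by norm_num) (by norm_num)))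
      rw [expVal_ghzDiag, expVal_ghzDiag] at h
      simpa only [Pi.add_apply, Pi.smul_apply, Pi.single_eq_same, hr0, smul_eq_mul, mul_one,
        mul_zero, add_zero] using h
  -- Attenuating the first outcome by `P / P'` sends `P'` to `P` and 1/2 to a weight at most 1/2,
  -- which convexity moves back to 1/2. For `P < P'` the resulting factor is below 1, whence strict
  -- growth.
  have hgrow : ∀ P P' : ℝ, 1 / 2 < P → P ≤ P' → P' ≤ 1 →
      D' (ghzMix c₀ c₁ P) (ghzMix c₀ c₁ (1 / 2)) ≤
        ENNReal.ofReal ((P - 1 / 2) / (P - P / P' * (1 / 2))) *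
          D' (ghzMix c₀ c₁ P') (ghzMix c₀ c₁ (1 / 2)) := by
    intro P P' hP hPP hP1
    have ha0 : 0 ≤ P / P' := div_nonneg (by linarith) (by linarith)
    have ha1 : P / P' ≤ 1 := by rw [div_le_one (by linarith)]; exact hPP
    have hE : ((P / P') • proj (ghzVec c₀)).PosSemidef := (proj_posSemidef _).smul ha0
    have hE' : (1 - (P / P') • proj (ghzVec c₀)).PosSemidef := by
      have e : 1 - (P / P') • proj (ghzVec c₀) =
          (1 - proj (ghzVec c₀)) + (1 - P / P') • proj (ghzVec c₀) := by
        rw [sub_smul, one_smul]; abel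
      rw [e]
      exact (one_sub_proj_posSemidef (ghzVec_unit c₀)).add
        ((proj_posSemidef _).smul (by linarith))
    have key : ∀ x, 0 ≤ x → x ≤ 1 → measurePrepare ((P / P') • proj (ghzVec c₀))
        (proj (ghzVec c₀)) (proj (ghzVec c₁)) (ghzMix c₀ c₁ x) =
        ghzMix c₀ c₁ (P / P' * x) := by
      intro x hx0 hx1
      rw [measurePrepare_state hE _ _ (isState_ghzMix c₀ c₁ hx0 hx1), Matrix.smul_mul, trace_smul,
        Complex.smul_re, ← expVal_eq_trace, expVal_ghzMix hc, smul_eq_mul, ghzMix]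
    have h := hD'.contractive _ (isChannel_measurePrepare hE hE' (isState_proj_ghzVec c₀)
      (isState_proj_ghzVec c₁)) _ _ (isState_ghzMix c₀ c₁ (P := P') (by linarith) hP1)
      (isState_ghzMix c₀ c₁ (P := 1 / 2) (by norm_num) (by norm_num))
    rw [key _ (by linarith) hP1, key _ (by norm_num) (by norm_num),
      div_mul_cancel₀ P (by linarith : P' ≠ 0)] at h
    refine (hD'.ghzMix_le c₀ c₁ hP (hPP.trans hP1) (q := P / P' * (1 / 2)) (by positivity)
      (by linarith)).trans ?_
    gcongr
  refine genuineLaw_of_bound hN (fun p hp => hD.self _ (isState_ghzDiag hp)) (fun ψ hψ ρ σ hρ hσ h1 h2 => ?_) hattain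
    (fun P hP P' hP' hPP => ?_) (fun hf P P' hP hPP hP1 hfin => ?_)
  · refine le_trans ?_ (hmeas ψ hψ ρ σ hρ hσ)
    refine (hD'.ghzMix_le c₀ c₁ h1 (hρ.expVal_le_one hψ) (expVal_nonneg ψ hσ.1) h2).trans ?_
    refine mul_le_of_le_one_left' (ENNReal.ofReal_le_one.2 ?_)
    rw [div_le_one (by linarith)]; linarith
  · refine (hgrow P P' hP.1 hPP hP'.2).trans ?_
    have h0 : 0 < P' := by linarith [hP'.1]
    have h1 : P / P' ≤ 1 := by rw [div_le_one h0]; exact hPP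
    refine mul_le_of_le_one_left' (ENNReal.ofReal_le_one.2 ?_)
    have := hP.1
    rw [div_le_one (by linarith)]; linarith
  · have hle := hgrow P P' hP hPP.le hP1
    have h1 : P / P' < 1 := by rw [div_lt_one (by linarith)]; exact hPP
    by_cases htop : D' (ghzMix c₀ c₁ P') (ghzMix c₀ c₁ (1 / 2)) = ⊤
    · rw [htop]; exact lt_top_iff_ne_top.2 hfin
    -- Faithfulness is known for `D` and not for the reference distance, so the value is first
    -- transported to a pair of `N`-qubit states.
    · have hne : D' (ghzMix c₀ c₁ P') (ghzMix c₀ c₁ (1 / 2)) ≠ 0 := by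
        intro h0
        obtain ⟨b₀⟩ := nonempty_index (N := N)
        obtain ⟨b₁, hb₁⟩ := exists_index_ne b₀
        have hr : (Pi.single b₁ 1 : Index N → ℝ) ∈ stdSimplex ℝ (Index N) :=
          single_mem_stdSimplex ℝ b₁
        rw [← hattain b₀ _ hr (by simp [hb₁.symm]) P' (by linarith) hP1] at h0
        have h2 := hf _ _ (isState_ghzDiag (mix_mem_stdSimplex b₀ hr (P := P') (by linarith) hP1))
          (isState_ghzDiag (mix_mem_stdSimplex b₀ hr (P := 1 / 2) (by norm_num) (by norm_num))) h0
        have h3 := congrArg (expVal (ghzVec b₀)) h2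
        rw [expVal_ghzDiag, expVal_ghzDiag] at h3
        simp [hb₁.symm] at h3
        linarith
      refine hle.trans_lt ?_
      have hκ : ENNReal.ofReal ((P - 1 / 2) / (P - P / P' * (1 / 2))) < 1 := by
        rw [ENNReal.ofReal_lt_one, div_lt_one (by linarith)]; linarith
      calc _ < 1 * D' (ghzMix c₀ c₁ P') (ghzMix c₀ c₁ (1 / 2)) :=
            (ENNReal.mul_lt_mul_iff_left hne htop).2 hκ
        _ = _ := one_mul _

theorem exists_genuineLaw (hN : 2 ≤ N) {D : QOp N → QOp N → ℝ≥0∞} (hD : IsContractiveConvex D) :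
    ∃ g : ℝ → ℝ≥0∞, GenuineLaw N D g := by
  have : NeZero N := ⟨by omega⟩
  obtain ⟨c₀⟩ := nonempty_index (N := N)
  obtain ⟨c₁, hc⟩ := exists_index_ne c₀
  exact ⟨_, genuineLaw_of_contractive hN hD hD hD.contractive hD.contractive hc.symm⟩

theorem exists_genuineLaw_family {D : (N : ℕ) → QOp N → QOp N → ℝ≥0∞}
    (hD : IsContractiveConvexFamily D) :
    ∃ g : ℝ → ℝ≥0∞, ∀ N : ℕ, 2 ≤ N → GenuineLaw N (D N) g := by
  obtain ⟨c₀⟩ := nonempty_index (N := 2)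
  obtain ⟨c₁, hc⟩ := exists_index_ne c₀
  exact ⟨_, fun N hN => genuineLaw_of_contractive hN (hD.each N) (hD.each 2)
    (hD.contractive N 2) (hD.contractive 2 N) hc.symm⟩

end Contractive

/-! ### Functional calculus of Hermitian matrices -/

section Calculus

variable {n : Type*} [Fintype n]

/-- The Cauchy-Schwarz inequality for the Hilbert-Schmidt inner product. -/
lemma re_trace_conjTranspose_mul_le (X Y : Matrix n n ℂ) :
    (Xᴴ * Y).trace.re ≤ Real.sqrt (Xᴴ * X).trace.re * Real.sqrt (Yᴴ * Y).trace.re := by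
  have hsymm : (Yᴴ * X).trace.re = (Xᴴ * Y).trace.re := by
    rw [← conjTranspose_conjTranspose X, ← conjTranspose_mul, trace_conjTranspose,
      conjTranspose_conjTranspose, Complex.star_def, Complex.conj_re]
  -- The quadratic is the squared Hilbert–Schmidt norm of `X - tY`; its discriminant gives the
  -- inequality.
  have hquad : ∀ t : ℝ, 0 ≤ (Yᴴ * Y).trace.re * (t * t) + (-2 * (Xᴴ * Y).trace.re) * t +
      (Xᴴ * X).trace.re := by
    intro t
    have h := re_trace_nonneg (posSemidef_conjTranspose_mul_self (X - t • Y))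
    simp only [conjTranspose_sub, conjTranspose_smul, star_trivial, sub_mul, mul_sub,
      Matrix.smul_mul, Matrix.mul_smul, trace_sub, trace_smul, Complex.sub_re, Complex.smul_re,
      smul_eq_mul, hsymm] at h
    linarith
  have hd := discrim_le_zero hquad
  rw [discrim] at hd
  rw [← Real.sqrt_mul (re_trace_nonneg (posSemidef_conjTranspose_mul_self X))]
  refine Real.le_sqrt_of_sq_le ?_
  linarith

variable [DecidableEq n]

/-- A matrix has finite spectrum, so every real function is continuous on it; logarithms and inverse
roots are allowed even at the eigenvalue 0. -/
lemma cfc_mul_cfc (f g : ℝ → ℝ) (A : Matrix n n ℂ) :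
    cfc f A * cfc g A = cfc (fun x => f x * g x) A :=
  (cfc_mul f g A (A.finite_real_spectrum.continuousOn _)
    (A.finite_real_spectrum.continuousOn _)).symm

lemma cfc_isHermitian (f : ℝ → ℝ) (A : Matrix n n ℂ) : (cfc f A).IsHermitian :=
  cfc_predicate (p := IsSelfAdjoint) f A

lemma cfc_posSemidef {f : ℝ → ℝ} (hf : ∀ x, 0 ≤ f x) (A : Matrix n n ℂ) :
    (cfc f A).PosSemidef := by
  have : cfc f A = (cfc (fun x => Real.sqrt (f x)) A)ᴴ * cfc (fun x => Real.sqrt (f x)) A := by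
    rw [(cfc_isHermitian _ A).eq, cfc_mul_cfc]
    simp only [Real.mul_self_sqrt (hf _)]
  rw [this]
  exact posSemidef_conjTranspose_mul_self _

lemma nonneg_of_mem_spectrum {A : Matrix n n ℂ} (hA : A.PosSemidef) {x : ℝ}
    (hx : x ∈ spectrum ℝ A) : 0 ≤ x := by
  rw [hA.1.spectrum_real_eq_range_eigenvalues] at hx
  obtain ⟨i, rfl⟩ := hx
  exact hA.eigenvalues_nonneg i

lemma cfc_congr_of_posSemidef {A : Matrix n n ℂ} (hA : A.PosSemidef) {f g : ℝ → ℝ}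
    (h : ∀ x, 0 ≤ x → f x = g x) : cfc f A = cfc g A :=
  cfc_congr fun _ hx => h _ (nonneg_of_mem_spectrum hA hx)

lemma cfc_sqrt_mul_self {A : Matrix n n ℂ} (hA : A.PosSemidef) :
    cfc Real.sqrt A * cfc Real.sqrt A = A := by
  rw [cfc_mul_cfc, cfc_congr_of_posSemidef hA fun x hx => Real.mul_self_sqrt hx,
    cfc_id' ℝ A hA.1.isSelfAdjoint]

end Calculus

/-! ### The trace distance and a two-outcome measurement -/

section Bounds

variable {n : Type*} [Fintype n] [DecidableEq n]

/-- Split `A = ρ - σ` into positive and negative parts. They have equal trace because `A` is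
traceless, so half of `Tr|A|` is the trace of the positive part, which dominates the expectation of
`A` in any unit vector. -/
lemma expVal_sub_le_trace_abs {ψ : n → ℂ} (hψ : star ψ ⬝ᵥ ψ = 1) {ρ σ : Matrix n n ℂ}
    (hρ : IsState ρ) (hσ : IsState σ) :
    expVal ψ ρ - expVal ψ σ ≤ 1 / 2 * (cfc (fun x : ℝ => |x|) (ρ - σ)).trace.re := by
  set A := ρ - σ with hA
  have hAs : IsSelfAdjoint A := (hρ.1.1.sub hσ.1.1).isSelfAdjoint
  have hadd : cfc (fun x : ℝ => |x|) A =
      cfc (fun x : ℝ => max x 0) A + cfc (fun x : ℝ => max (-x) 0) A := by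
    rw [← cfc_add A (fun x : ℝ => max x 0) (fun x : ℝ => max (-x) 0)]
    congr 1
    funext x
    rcases le_total 0 x with h | h
    · rw [abs_of_nonneg h, max_eq_left h, max_eq_right (by linarith), add_zero]
    · rw [abs_of_nonpos h, max_eq_right h, max_eq_left (by linarith), zero_add]
  have hsub : A = cfc (fun x : ℝ => max x 0) A - cfc (fun x : ℝ => max (-x) 0) A := by
    rw [← cfc_sub (fun x : ℝ => max x 0) (fun x : ℝ => max (-x) 0) A]
    conv_lhs => rw [← cfc_id' ℝ A hAs]
    congr 1
    funext x
    rcases le_total 0 x with h | h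
    · rw [max_eq_left h, max_eq_right (by linarith), sub_zero]
    · rw [max_eq_right h, max_eq_left (by linarith)]; ring
  have hp : (cfc (fun x : ℝ => max x 0) A).PosSemidef := cfc_posSemidef (fun x => le_max_right _ _) A
  have hm : (cfc (fun x : ℝ => max (-x) 0) A).PosSemidef :=
    cfc_posSemidef (fun x => le_max_right _ _) A
  have htr : A.trace.re = 0 := by rw [hA, trace_sub, hρ.2, hσ.2]; simp
  have h1 : expVal ψ ρ - expVal ψ σ = expVal ψ A := by rw [hA, expVal_sub]
  have h2 := expVal_le_trace hψ hp
  have h3 := expVal_nonneg ψ hm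
  rw [hsub, trace_sub, Complex.sub_re] at htr
  rw [h1, hadd, trace_add, Complex.add_re]
  have h4 : expVal ψ A = expVal ψ (cfc (fun x : ℝ => max x 0) A) -
      expVal ψ (cfc (fun x : ℝ => max (-x) 0) A) := by
    rw [← expVal_sub, ← hsub]
  linarith

/-! ### Fidelity, affinity and a two-outcome measurement -/

/-- Cauchy–Schwarz for `E A W†` and `E B`; the contraction `W` can only decrease the norm of the
first. Summing over a projection and its complement compares a quantum overlap with a classical one.
-/
lemma re_trace_projection_le {ρ σ W A B E : Matrix n n ℂ} (hA : A.IsHermitian)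
    (hB : B.IsHermitian) (hAA : A * A = ρ) (hBB : B * B = σ) (hW : (1 - Wᴴ * W).PosSemidef)
    (hE : E.IsHermitian) (hEE : E * E = E) :
    (W * A * E * B).trace.re ≤ Real.sqrt (E * ρ).trace.re * Real.sqrt (E * σ).trace.re := by
  have h := re_trace_conjTranspose_mul_le (E * A * Wᴴ) (E * B)
  have e1 : (E * A * Wᴴ)ᴴ = W * A * E := by
    rw [conjTranspose_mul, conjTranspose_mul, conjTranspose_conjTranspose, hA.eq, hE.eq,
      Matrix.mul_assoc]
  have e2 : (E * B)ᴴ = B * E := by rw [conjTranspose_mul, hB.eq, hE.eq]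
  have e3 : W * A * E * (E * B) = W * A * E * B := by
    rw [← Matrix.mul_assoc, Matrix.mul_assoc (W * A) E E, hEE]
  have e4 : (B * E * (E * B)).trace = (E * σ).trace := by
    rw [← Matrix.mul_assoc, Matrix.mul_assoc B E E, hEE, trace_mul_comm, ← Matrix.mul_assoc,
      trace_mul_comm, hBB]
  have e5 : (W * A * E * (E * A * Wᴴ)).trace.re ≤ (E * ρ).trace.re := by
    have hpos : (A * E * A).PosSemidef := by
      have : A * E * A = (E * A)ᴴ * (E * A) := by
        rw [conjTranspose_mul, hA.eq, hE.eq, ← Matrix.mul_assoc, Matrix.mul_assoc A E E, hEE]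
      rw [this]; exact posSemidef_conjTranspose_mul_self _
    have h0 := re_trace_mul_nonneg hW hpos
    rw [sub_mul, one_mul, trace_sub, Complex.sub_re] at h0
    have e6 : (W * A * E * (E * A * Wᴴ)).trace = (Wᴴ * W * (A * E * A)).trace := by
      have : W * A * E * (E * A * Wᴴ) = W * (A * E * A) * Wᴴ := by
        simp only [← Matrix.mul_assoc]
        rw [Matrix.mul_assoc (W * A) E E, hEE]
      rw [this, trace_mul_comm, ← Matrix.mul_assoc]
    have e7 : (A * E * A).trace = (E * ρ).trace := by
      rw [trace_mul_comm, ← Matrix.mul_assoc, hAA, trace_mul_comm]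
    rw [e6, ← e7]; linarith
  rw [e1, e2, e3, e4] at h
  exact h.trans (mul_le_mul_of_nonneg_right (Real.sqrt_le_sqrt e5) (Real.sqrt_nonneg _))

/-- For `P ≥ 1/2 ≥ q`, the classical fidelity of `(P, 1-P)` and `(q, 1-q)` is at most that of
`(P, 1-P)` and the uniform distribution. -/
lemma sqrt_mul_add_le {P q : ℝ} (hP : 1 / 2 ≤ P) (hq : q ≤ 1 / 2) (hq0 : 0 ≤ q) :
    Real.sqrt P * Real.sqrt q + Real.sqrt (1 - P) * Real.sqrt (1 - q) ≤
      Real.sqrt 2 / 2 * (Real.sqrt (1 - P) + Real.sqrt P) := by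
  have h1 : Real.sqrt (1 - P) ≤ Real.sqrt P := Real.sqrt_le_sqrt (by linarith)
  have h2 : Real.sqrt q ≤ Real.sqrt (1 - q) := Real.sqrt_le_sqrt (by linarith)
  have h3 : Real.sqrt q + Real.sqrt (1 - q) ≤ Real.sqrt 2 := by
    refine Real.le_sqrt_of_sq_le ?_
    nlinarith [Real.sq_sqrt hq0, Real.sq_sqrt (by linarith : 0 ≤ 1 - q),
      sq_nonneg (Real.sqrt q - Real.sqrt (1 - q))]
  have h4 := Real.sqrt_nonneg P
  have h5 := Real.sqrt_nonneg (1 - P)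
  -- Chebyshev's sum inequality: the two pairs of roots are oppositely ordered, so the sum of
  -- products is at most half the product of the sums.
  nlinarith [mul_nonneg (sub_nonneg.2 h1) (sub_nonneg.2 h2),
    mul_nonneg (add_nonneg h4 h5) (sub_nonneg.2 h3)]

lemma re_trace_mul_mul_le {ψ : n → ℂ} (hψ : star ψ ⬝ᵥ ψ = 1) {ρ σ W A B : Matrix n n ℂ}
    (hρ : IsState ρ) (hσ : IsState σ) (hA : A.IsHermitian) (hB : B.IsHermitian)
    (hAA : A * A = ρ) (hBB : B * B = σ) (hW : (1 - Wᴴ * W).PosSemidef)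
    (hP : 1 / 2 ≤ expVal ψ ρ) (hq : expVal ψ σ ≤ 1 / 2) :
    (W * A * B).trace.re ≤
      Real.sqrt 2 / 2 * (Real.sqrt (1 - expVal ψ ρ) + Real.sqrt (expVal ψ ρ)) := by
  refine le_trans ?_ (sqrt_mul_add_le hP hq (expVal_nonneg ψ hσ.1))
  have hE := proj_isHermitian ψ
  have hEE := proj_mul_self hψ
  have h1 := re_trace_projection_le hA hB hAA hBB hW hE hEE
  have h2 := re_trace_projection_le (E := 1 - proj ψ) hA hB hAA hBB hW
    (isHermitian_one.sub hE) (by simp [mul_sub, sub_mul, hEE])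
  have e : ∀ τ : Matrix n n ℂ, IsState τ → ((1 - proj ψ) * τ).trace.re = 1 - expVal ψ τ := by
    intro τ hτ
    rw [sub_mul, one_mul, trace_sub, hτ.2, Complex.sub_re, Complex.one_re, expVal_eq_trace]
  rw [e ρ hρ, e σ hσ] at h2
  rw [← expVal_eq_trace, ← expVal_eq_trace] at h1
  have e2 : W * A * B = W * A * proj ψ * B + W * A * (1 - proj ψ) * B := by
    rw [← add_mul, ← mul_add, add_sub_cancel, mul_one]
  rw [e2, trace_add, Complex.add_re]
  linarith

/-- The root fidelity is `Tr (W √ρ √σ)` for some contraction `W`. -/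
lemma exists_contraction_rootFidelity {ρ σ : Matrix n n ℂ} (hρ : ρ.PosSemidef) :
    ∃ W : Matrix n n ℂ, (1 - Wᴴ * W).PosSemidef ∧
      rootFidelity ρ σ = (W * cfc Real.sqrt ρ * cfc Real.sqrt σ).trace.re := by
  set A := cfc Real.sqrt ρ with hA
  set B := cfc Real.sqrt σ with hB
  have hAh : Aᴴ = A := (cfc_isHermitian _ _).eq
  have hBh : Bᴴ = B := (cfc_isHermitian _ _).eq
  have hAA : A * A = ρ := cfc_sqrt_mul_self hρ
  set T := B * ρ * B with hT
  have hTpos : T.PosSemidef := by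
    have := hρ.mul_mul_conjTranspose_same B
    rwa [hBh] at this
  have hTid : cfc (fun x : ℝ => x) T = T := cfc_id' ℝ T hTpos.1.isSelfAdjoint
  set R := cfc (fun x : ℝ => (Real.sqrt x)⁻¹) T with hR
  have hRh : Rᴴ = R := (cfc_isHermitian _ _).eq
  have hRT : R * T = cfc Real.sqrt T := by
    have h1 : R * T = R * cfc (fun x : ℝ => x) T := by rw [hTid]
    rw [h1, hR, cfc_mul_cfc]
    refine cfc_congr_of_posSemidef hTpos fun x hx => ?_
    rcases hx.eq_or_lt with rfl | hx'
    · simp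
    · have := (Real.sqrt_pos.2 hx').ne'
      field_simp
      exact (Real.sq_sqrt hx).symm
  have hRTRR : R * T * R * R = R := by
    rw [hRT, hR, cfc_mul_cfc, cfc_mul_cfc]
    refine cfc_congr_of_posSemidef hTpos fun x hx => ?_
    rcases hx.eq_or_lt with rfl | hx'
    · simp
    · have := (Real.sqrt_pos.2 hx').ne'
      field_simp
  have hTAB : T = B * A * A * B := by rw [hT, Matrix.mul_assoc B A A, hAA]
  -- This is the polar factor of `√σ √ρ`, with `R` the pseudo-inverse of `√T`: the convention `0⁻¹ =
  -- 0` makes it a partial isometry, so no invertibility is needed.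
  refine ⟨R * (B * A), one_sub_posSemidef_of_idempotent (isHermitian_conjTranspose_mul_self _) ?_,
    ?_⟩
  · have hWh : (R * (B * A))ᴴ = A * B * R := by
      rw [conjTranspose_mul, conjTranspose_mul, hAh, hBh, hRh]
    have h1 : R * (B * A) * (A * B * R) * (R * (B * A)) = R * (B * A) := by
      have : R * (B * A) * (A * B * R) * (R * (B * A)) = R * T * R * R * (B * A) := by
        rw [hTAB]; simp only [Matrix.mul_assoc]
      rw [this, hRTRR]
    rw [hWh]
    calc A * B * R * (R * (B * A)) * (A * B * R * (R * (B * A)))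
        = A * B * R * (R * (B * A) * (A * B * R) * (R * (B * A))) := by
          simp only [Matrix.mul_assoc]
      _ = _ := by rw [h1]
  · have : R * (B * A) * A * B = R * T := by rw [hTAB]; simp only [Matrix.mul_assoc]
    rw [this, hRT, rootFidelity]

lemma rootFidelity_nonneg (ρ σ : Matrix n n ℂ) : 0 ≤ rootFidelity ρ σ :=
  re_trace_nonneg (cfc_posSemidef Real.sqrt_nonneg _)

lemma rootFidelity_le {ψ : n → ℂ} (hψ : star ψ ⬝ᵥ ψ = 1) {ρ σ : Matrix n n ℂ}
    (hρ : IsState ρ) (hσ : IsState σ) (hP : 1 / 2 ≤ expVal ψ ρ) (hq : expVal ψ σ ≤ 1 / 2) :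
    rootFidelity ρ σ ≤
      Real.sqrt 2 / 2 * (Real.sqrt (1 - expVal ψ ρ) + Real.sqrt (expVal ψ ρ)) := by
  obtain ⟨W, hW, h⟩ := exists_contraction_rootFidelity (σ := σ) hρ.1
  rw [h]
  exact re_trace_mul_mul_le hψ hρ hσ (cfc_isHermitian _ _) (cfc_isHermitian _ _)
    (cfc_sqrt_mul_self hρ.1) (cfc_sqrt_mul_self hσ.1) hW hP hq

lemma affinity_le {ψ : n → ℂ} (hψ : star ψ ⬝ᵥ ψ = 1) {ρ σ : Matrix n n ℂ}
    (hρ : IsState ρ) (hσ : IsState σ) (hP : 1 / 2 ≤ expVal ψ ρ) (hq : expVal ψ σ ≤ 1 / 2) :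
    (cfc Real.sqrt ρ * cfc Real.sqrt σ).trace.re ≤
      Real.sqrt 2 / 2 * (Real.sqrt (1 - expVal ψ ρ) + Real.sqrt (expVal ψ ρ)) := by
  have := re_trace_mul_mul_le (W := 1) hψ hρ hσ (cfc_isHermitian Real.sqrt ρ)
    (cfc_isHermitian Real.sqrt σ) (cfc_sqrt_mul_self hρ.1) (cfc_sqrt_mul_self hσ.1)
    (by simpa using PosSemidef.zero) hP hq
  rwa [one_mul] at this

/-! ### Relative entropy and a two-outcome measurement -/

lemma hasDerivAt_mul_log {a s r u : ℝ} (h : a ≠ 0 → 0 < s ∧ 0 < r) (hu : u ∈ Set.Icc (0 : ℝ) 1) :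
    HasDerivAt (fun u => a * Real.log ((1 - u) * s + u * r))
      (a * ((r - s) / ((1 - u) * s + u * r))) u := by
  by_cases ha : a = 0
  · simpa [ha] using hasDerivAt_const u (0 : ℝ)
  · obtain ⟨hs, hr⟩ := h ha
    have hpos : 0 < (1 - u) * s + u * r := by
      rcases hu.1.eq_or_lt with h0 | h0
      · rw [← h0]; linarith
      · have := mul_pos h0 hr
        have := mul_nonneg (sub_nonneg.2 hu.2) hs.le
        linarith
    have h1 : HasDerivAt (fun u : ℝ => (1 - u) * s + u * r) (r - s) u := by
      have := (((hasDerivAt_id' u).const_sub 1).mul_const s).add ((hasDerivAt_id' u).mul_const r)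
      exact this.congr_deriv (by ring)
    exact (h1.log hpos.ne').const_mul a

lemma one_sub_mul_deriv_eq {a s r u : ℝ} (h : a ≠ 0 → 0 < s ∧ 0 < r) (hu : u ∈ Set.Ioo (0 : ℝ) 1) :
    (1 - u) * (a * ((r - s) / ((1 - u) * s + u * r))) = a * (r / ((1 - u) * s + u * r)) - a := by
  by_cases ha : a = 0
  · simp [ha]
  · obtain ⟨hs, hr⟩ := h ha
    have hpos : 0 < (1 - u) * s + u * r :=
      add_pos (mul_pos (sub_pos.2 hu.2) hs) (mul_pos hu.1 hr)
    field_simp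
    ring

/-- Integration of a bound between weighted resolvents to a bound between weighted logarithms. -/
lemma sum_mul_log_le {ι : Type*} [Fintype ι] {a s r : ι → ℝ} (h : ∀ t, a t ≠ 0 → 0 < s t ∧ 0 < r t)
    (hsum : ∑ t, a t = 1) {P : ℝ} (hP : 0 < P) (hP1 : P ≤ 1)
    (hineq : ∀ u ∈ Set.Ioo (0 : ℝ) 1, P * (P / ((1 - u) * (1 / 2) + u * P)) +
      (1 - P) * ((1 - P) / ((1 - u) * (1 / 2) + u * (1 - P))) ≤
        ∑ t, a t * (r t / ((1 - u) * s t + u * r t))) :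
    ∑ t, a t * Real.log (s t) + (Real.log 2 + P * Real.log P + (1 - P) * Real.log (1 - P)) ≤
      ∑ t, a t * Real.log (r t) := by
  have hp1 : P ≠ 0 → (0 : ℝ) < 1 / 2 ∧ 0 < P := fun _ => ⟨by norm_num, hP⟩
  have hp2 : 1 - P ≠ 0 → (0 : ℝ) < 1 / 2 ∧ 0 < 1 - P := fun h0 =>
    ⟨by norm_num, lt_of_le_of_ne (by linarith) (Ne.symm h0)⟩
  set F : ℝ → ℝ := fun u => ∑ t, a t * Real.log ((1 - u) * s t + u * r t) -
    (P * Real.log ((1 - u) * (1 / 2) + u * P) +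
      (1 - P) * Real.log ((1 - u) * (1 / 2) + u * (1 - P))) with hF
  have hderiv : ∀ u ∈ Set.Icc (0 : ℝ) 1, HasDerivAt F
      (∑ t, a t * ((r t - s t) / ((1 - u) * s t + u * r t)) -
        (P * ((P - 1 / 2) / ((1 - u) * (1 / 2) + u * P)) +
          (1 - P) * ((1 - P - 1 / 2) / ((1 - u) * (1 / 2) + u * (1 - P))))) u := fun u hu =>
    (HasDerivAt.fun_sum fun t _ => hasDerivAt_mul_log (h t) hu).sub
      ((hasDerivAt_mul_log hp1 hu).add (hasDerivAt_mul_log hp2 hu))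
  have hmono : MonotoneOn F (Set.Icc 0 1) := by
    refine monotoneOn_of_deriv_nonneg (convex_Icc 0 1)
      (fun u hu => (hderiv u hu).continuousAt.continuousWithinAt) ?_ ?_
    · intro u hu
      exact (hderiv u (interior_subset hu)).differentiableAt.differentiableWithinAt
    · intro u hu
      rw [(hderiv u (interior_subset hu)).deriv]
      rw [interior_Icc] at hu
      have h1u : 0 < 1 - u := sub_pos.2 hu.2
      -- Multiplication by `1 - u` turns the derivative into a difference of resolvent sums: both
      -- families of weights have total 1, so the constants cancel.
      refine nonneg_of_mul_nonneg_right (a := 1 - u) ?_ h1u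
      rw [mul_sub, mul_add, one_sub_mul_deriv_eq hp1 hu, one_sub_mul_deriv_eq hp2 hu,
        Finset.mul_sum, Finset.sum_congr rfl fun t _ => one_sub_mul_deriv_eq (h t) hu,
        Finset.sum_sub_distrib, hsum]
      linarith [hineq u hu]
  have h01 := hmono (Set.left_mem_Icc.2 zero_le_one) (Set.right_mem_Icc.2 zero_le_one) zero_le_one
  simp only [hF, sub_zero, one_mul, zero_mul, add_zero, sub_self, zero_add] at h01
  have hhalf : Real.log (1 / 2) = -Real.log 2 := by rw [one_div, Real.log_inv]
  rw [hhalf] at h01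
  linarith

/-- The resolvent bound of the uniform two-outcome distribution against `(q, 1-q)`, `q ≤ 1/2`. -/
lemma resolvent_bound {P q u : ℝ} (hP : 1 / 2 < P) (hP1 : P ≤ 1) (hq : q ≤ 1 / 2)
    (hu : u ∈ Set.Ioo (0 : ℝ) 1) :
    ∃ x y : ℝ, P * (P / ((1 - u) * (1 / 2) + u * P)) +
      (1 - P) * ((1 - P) / ((1 - u) * (1 / 2) + u * (1 - P))) ≤
        2 * (x * P + y * (1 - P)) - (1 - u) * (x ^ 2 * q + y ^ 2 * (1 - q)) -
          u * (x ^ 2 * P + y ^ 2 * (1 - P)) := by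
  have h1u : 0 < 1 - u := sub_pos.2 hu.2
  have hm1 : 0 < (1 - u) * (1 / 2) + u * P :=
    add_pos (mul_pos h1u (by norm_num)) (mul_pos hu.1 (by linarith))
  have hm2 : 0 < (1 - u) * (1 / 2) + u * (1 - P) :=
    add_pos_of_pos_of_nonneg (mul_pos h1u (by norm_num)) (mul_nonneg hu.1.le (by linarith))
  -- These values maximise the quadratic expression when `q = 1/2`. They satisfy `x ≥ y ≥ 0`, so
  -- lowering `q` below 1/2 only increases the right-hand side.
  refine ⟨P / ((1 - u) * (1 / 2) + u * P), (1 - P) / ((1 - u) * (1 / 2) + u * (1 - P)), ?_⟩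
  set m1 := (1 - u) * (1 / 2) + u * P with hm1d
  set m2 := (1 - u) * (1 / 2) + u * (1 - P) with hm2d
  have hx : P / m1 * m1 = P := div_mul_cancel₀ _ hm1.ne'
  have hy : (1 - P) / m2 * m2 = 1 - P := div_mul_cancel₀ _ hm2.ne'
  have hyx : (1 - P) / m2 ≤ P / m1 := by
    rw [div_le_div_iff₀ hm2 hm1, hm1d, hm2d]
    nlinarith
  have hy0 : 0 ≤ (1 - P) / m2 := div_nonneg (by linarith) hm2.le
  set x := P / m1
  set y := (1 - P) / m2
  have hsq : 0 ≤ (1 - u) * ((1 / 2 - q) * (x ^ 2 - y ^ 2)) :=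
    mul_nonneg h1u.le (mul_nonneg (by linarith) (by nlinarith))
  have e : 2 * (x * P + y * (1 - P)) - (1 - u) * (x ^ 2 * q + y ^ 2 * (1 - q)) -
      u * (x ^ 2 * P + y ^ 2 * (1 - P)) = 2 * (x * P + y * (1 - P)) - x * (x * m1) - y * (y * m2) +
        (1 - u) * ((1 / 2 - q) * (x ^ 2 - y ^ 2)) := by
    rw [hm1d, hm2d]; ring
  rw [e, hx, hy]
  linarith

lemma trace_diagonal_mul_diagonal_mul (b a : n → ℝ) (Z Z' : Matrix n n ℂ) :
    (diagonal (fun i => (b i : ℂ)) * Zᴴ * diagonal (fun j => (a j : ℂ)) * Z').trace =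
      ∑ t : n × n, (b t.1 : ℂ) * (a t.2 : ℂ) * (star (Z t.2 t.1) * Z' t.2 t.1) := by
  rw [Fintype.sum_prod_type, trace]
  refine Finset.sum_congr rfl fun i _ => ?_
  rw [diag_apply, Matrix.mul_apply]
  refine Finset.sum_congr rfl fun j _ => ?_
  rw [mul_diagonal, diagonal_mul, conjTranspose_apply]
  ring

lemma exists_diagonalization {A : Matrix n n ℂ} (hA : A.IsHermitian) :
    ∃ U : Matrix n n ℂ, Uᴴ * U = 1 ∧ U * Uᴴ = 1 ∧ ∀ f : ℝ → ℝ,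
      cfc f A = U * diagonal (fun i => (f (hA.eigenvalues i) : ℂ)) * Uᴴ := by
  refine ⟨hA.eigenvectorUnitary, mem_unitaryGroup_iff'.1 hA.eigenvectorUnitary.2,
    mem_unitaryGroup_iff.1 hA.eigenvectorUnitary.2, fun f => ?_⟩
  rw [hA.cfc_eq, IsHermitian.cfc, Unitary.conjStarAlgAut_apply]
  rfl

lemma le_div_of_complex_square {c : ℝ} (hc : 0 ≤ c) {r : ℝ} (hr0 : 0 ≤ r) (hr : c = 0 → r = 0)
    (z w : ℂ) :
    2 * (r * (star z * w).re) - c * ‖w‖ ^ 2 ≤ r * ‖z‖ ^ 2 * (r / c) := by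
  rcases hc.eq_or_lt with h | h
  · rw [hr h.symm, ← h]; simp
  · have h1 : (star z * w).re ≤ ‖z‖ * ‖w‖ := by
      refine (Complex.re_le_norm _).trans ?_
      rw [norm_mul, norm_star]
    have h2 : r * (star z * w).re ≤ r * (‖z‖ * ‖w‖) := mul_le_mul_of_nonneg_left h1 hr0
    have h3 : r * ‖z‖ ^ 2 * (r / c) = (r * ‖z‖) ^ 2 / c := by
      field_simp
    rw [h3, le_div_iff₀ h]
    nlinarith [sq_nonneg (r * ‖z‖ - c * ‖w‖)]

lemma star_mul_self_eq (z : ℂ) : star z * z = ((‖z‖ ^ 2 : ℝ) : ℂ) := by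
  rw [Complex.star_def, Complex.conj_mul']; push_cast; rfl

/-- The variational principle `2 Re⟨z, w⟩ - c‖w‖² ≤ ‖z‖² / c`, applied entrywise to `X` written
between the eigenbases of `σ` and `ρ`; there `X ↦ (1 - u) σX + u Xρ` is diagonal. A trial `X` built
from a two-outcome measurement then yields a lower bound in terms of the outcome probabilities only.
-/
lemma sum_resolvent_ge {ρ σ U V X : Matrix n n ℂ} {r s : n → ℝ} (hr : ∀ i, 0 ≤ r i)
    (hs : ∀ j, 0 ≤ s j) (hρ : ρ = U * diagonal (fun i => (r i : ℂ)) * Uᴴ)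
    (hσ : σ = V * diagonal (fun j => (s j : ℂ)) * Vᴴ) (hU : U * Uᴴ = 1) (hV : V * Vᴴ = 1)
    (hX : X.IsHermitian) {u : ℝ} (hu : u ∈ Set.Ioo (0 : ℝ) 1) :
    2 * (ρ * X).trace.re - (1 - u) * (σ * (X * X)).trace.re - u * (ρ * (X * X)).trace.re ≤
      ∑ t : n × n, r t.1 * ‖(Vᴴ * U) t.2 t.1‖ ^ 2 *
        (r t.1 / ((1 - u) * s t.2 + u * r t.1)) := by
  set Y := Vᴴ * X * U with hY
  have hYh : Yᴴ = Uᴴ * X * V := by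
    rw [hY, conjTranspose_mul, conjTranspose_mul, conjTranspose_conjTranspose, hX.eq,
      Matrix.mul_assoc]
  have hone : diagonal (fun _ : n => ((1 : ℝ) : ℂ)) = 1 := by simp
  have e1 : (ρ * X).trace.re =
      ∑ t : n × n, r t.1 * (star ((Vᴴ * U) t.2 t.1) * Y t.2 t.1).re := by
    have h := trace_diagonal_mul_diagonal_mul r (fun _ => 1) (Vᴴ * U) Y
    rw [hone, mul_one, conjTranspose_mul, conjTranspose_conjTranspose] at h
    have h2 : (ρ * X).trace = (diagonal (fun i => (r i : ℂ)) * (Uᴴ * V) * Y).trace := by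
      rw [hρ, hY, Matrix.mul_assoc, Matrix.mul_assoc, trace_mul_comm]
      have : diagonal (fun i => (r i : ℂ)) * (Uᴴ * V) * (Vᴴ * X * U) =
          diagonal (fun i => (r i : ℂ)) * (Uᴴ * (V * Vᴴ) * X) * U := by
        simp only [Matrix.mul_assoc]
      rw [this, hV, mul_one]
    rw [h2, h, Complex.re_sum]
    refine Finset.sum_congr rfl fun t _ => ?_
    rw [Complex.ofReal_one, mul_one, Complex.re_ofReal_mul]
  have e2 : (ρ * (X * X)).trace.re = ∑ t : n × n, r t.1 * ‖Y t.2 t.1‖ ^ 2 := by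
    have h := trace_diagonal_mul_diagonal_mul r (fun _ => 1) Y Y
    rw [hone, mul_one] at h
    have h2 : (ρ * (X * X)).trace = (diagonal (fun i => (r i : ℂ)) * Yᴴ * Y).trace := by
      rw [hρ, hYh, hY, Matrix.mul_assoc, Matrix.mul_assoc, trace_mul_comm]
      have : diagonal (fun i => (r i : ℂ)) * (Uᴴ * X * V) * (Vᴴ * X * U) =
          diagonal (fun i => (r i : ℂ)) * (Uᴴ * (X * (V * Vᴴ) * X)) * U := by
        simp only [Matrix.mul_assoc]
      rw [this, hV, mul_one]
    rw [h2, h, Complex.re_sum]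
    refine Finset.sum_congr rfl fun t _ => ?_
    rw [Complex.ofReal_one, mul_one, Complex.re_ofReal_mul, star_mul_self_eq, Complex.ofReal_re]
  have e3 : (σ * (X * X)).trace.re = ∑ t : n × n, s t.2 * ‖Y t.2 t.1‖ ^ 2 := by
    have h := trace_diagonal_mul_diagonal_mul (fun _ => 1) s Y Y
    rw [hone, one_mul] at h
    have h2 : (σ * (X * X)).trace = (Yᴴ * diagonal (fun i => (s i : ℂ)) * Y).trace := by
      rw [hYh, hY]
      have : Uᴴ * X * V * diagonal (fun i => (s i : ℂ)) * (Vᴴ * X * U) =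
          Uᴴ * (X * (V * diagonal (fun i => (s i : ℂ)) * Vᴴ) * X * U) := by
        simp only [Matrix.mul_assoc]
      rw [this, ← hσ, trace_mul_comm Uᴴ, Matrix.mul_assoc _ U, hU, mul_one, trace_mul_comm (X * σ) X,
        ← Matrix.mul_assoc X, trace_mul_comm]
    rw [h2, h, Complex.re_sum]
    refine Finset.sum_congr rfl fun t _ => ?_
    rw [Complex.ofReal_one, one_mul, Complex.re_ofReal_mul, star_mul_self_eq, Complex.ofReal_re]
  rw [e1, e2, e3, Finset.mul_sum, Finset.mul_sum, Finset.mul_sum, ← Finset.sum_sub_distrib,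
    ← Finset.sum_sub_distrib]
  refine Finset.sum_le_sum fun t _ => ?_
  have h1 : 0 ≤ (1 - u) * s t.2 := mul_nonneg (sub_nonneg.2 hu.2.le) (hs _)
  have h2 : 0 ≤ u * r t.1 := mul_nonneg hu.1.le (hr _)
  have h3 : (1 - u) * s t.2 + u * r t.1 = 0 → r t.1 = 0 := fun h0 =>
    (mul_eq_zero.1 (by linarith : u * r t.1 = 0)).resolve_left hu.1.ne'
  refine le_trans (le_of_eq ?_) (le_div_of_complex_square (add_nonneg h1 h2) (hr _) h3 _ (Y t.2 t.1))
  ring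

/-- The relative entropy of two states on opposite sides of `1/2` for some rank-one measurement is
bounded below by that of the measured binary distribution and the uniform one. -/
lemma gRE_le_relativeEntropy {ψ : n → ℂ} (hψ : star ψ ⬝ᵥ ψ = 1) {ρ σ : Matrix n n ℂ}
    (hρ : IsState ρ) (hσ : IsState σ) (hP : 1 / 2 < expVal ψ ρ) (hq : expVal ψ σ ≤ 1 / 2)
    (hker : ∀ v : n → ℂ, σ *ᵥ v = 0 → ρ *ᵥ v = 0) :
    gRE (expVal ψ ρ) ≤ (ρ * (cfc (Real.logb 2) ρ - cfc (Real.logb 2) σ)).trace.re := by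
  obtain ⟨U, hU, hU', hUf⟩ := exists_diagonalization hρ.1.1
  obtain ⟨V, hV, hV', hVf⟩ := exists_diagonalization hσ.1.1
  have hr := hρ.1.eigenvalues_nonneg
  have hs := hσ.1.eigenvalues_nonneg
  set r := hρ.1.1.eigenvalues
  set s := hσ.1.1.eigenvalues
  have hρd : ρ = U * diagonal (fun i => (r i : ℂ)) * Uᴴ := by
    rw [← hUf fun x => x, cfc_id' ℝ ρ hρ.1.1.isSelfAdjoint]
  have hσd : σ = V * diagonal (fun i => (s i : ℂ)) * Vᴴ := by
    rw [← hVf fun x => x, cfc_id' ℝ σ hσ.1.1.isSelfAdjoint]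
  set C := Vᴴ * U with hC
  have hCh : Cᴴ = Uᴴ * V := by rw [hC, conjTranspose_mul, conjTranspose_conjTranspose]
  have hCC : Cᴴ * C = 1 := by
    rw [hCh, hC, Matrix.mul_assoc, ← Matrix.mul_assoc V, hV', one_mul, hU]
  have hone : diagonal (fun _ : n => ((1 : ℝ) : ℂ)) = 1 := by simp
  have hsame : ∀ f : ℝ → ℝ, (ρ * cfc f ρ).trace.re =
      ∑ t : n × n, r t.1 * ‖C t.2 t.1‖ ^ 2 * f (r t.1) := by
    intro f
    have h := trace_diagonal_mul_diagonal_mul (fun i => r i * f (r i)) (fun _ => 1) C C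
    rw [hone, mul_one, Matrix.mul_assoc, hCC, mul_one] at h
    have h2 : (ρ * cfc f ρ).trace = (diagonal fun i => ((r i * f (r i) : ℝ) : ℂ)).trace := by
      have : ρ * cfc f ρ = U * (diagonal (fun i => (r i : ℂ)) *
          diagonal (fun i => (f (r i) : ℂ)) * Uᴴ) := by
        rw [hUf f]
        nth_rw 1 [hρd]
        simp only [Matrix.mul_assoc]
        rw [← Matrix.mul_assoc Uᴴ U, hU, one_mul]
      rw [this, trace_mul_comm, Matrix.mul_assoc, hU, mul_one, diagonal_mul_diagonal]
      simp only [Complex.ofReal_mul]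
    rw [h2, h, Complex.re_sum]
    refine Finset.sum_congr rfl fun t _ => ?_
    rw [Complex.ofReal_one, mul_one, Complex.re_ofReal_mul, star_mul_self_eq, Complex.ofReal_re]
    ring
  have hcross : ∀ f : ℝ → ℝ, (ρ * cfc f σ).trace.re =
      ∑ t : n × n, r t.1 * ‖C t.2 t.1‖ ^ 2 * f (s t.2) := by
    intro f
    have h := trace_diagonal_mul_diagonal_mul r (fun j => f (s j)) C C
    have h2 : (ρ * cfc f σ).trace = (diagonal (fun i => (r i : ℂ)) * Cᴴ *
        diagonal (fun j => (f (s j) : ℂ)) * C).trace := by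
      rw [hCh, hC, hVf f]
      nth_rw 1 [hρd]
      rw [Matrix.mul_assoc, Matrix.mul_assoc, trace_mul_comm]
      simp only [Matrix.mul_assoc]
    rw [h2, h, Complex.re_sum]
    refine Finset.sum_congr rfl fun t _ => ?_
    rw [← Complex.ofReal_mul, Complex.re_ofReal_mul, star_mul_self_eq, Complex.ofReal_re]
    ring
  have hsum : ∑ t : n × n, r t.1 * ‖C t.2 t.1‖ ^ 2 = 1 := by
    have h := hsame fun _ => 1
    rw [cfc_const_one ℝ ρ hρ.1.1.isSelfAdjoint, mul_one, hρ.2] at h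
    simpa using h.symm
  -- The kernel condition enters only here: an eigenvector of `σ` with eigenvalue 0 is killed by
  -- `ρ`, so it carries no weight.
  have hpos : ∀ t : n × n, r t.1 * ‖C t.2 t.1‖ ^ 2 ≠ 0 → 0 < s t.2 ∧ 0 < r t.1 := by
    intro t ht
    have hr0 : r t.1 ≠ 0 := left_ne_zero_of_mul ht
    refine ⟨lt_of_le_of_ne (hs _) fun h0 => ht ?_, lt_of_le_of_ne (hr _) hr0.symm⟩
    have h1 : σ *ᵥ (V *ᵥ Pi.single t.2 1) = 0 := by
      rw [mulVec_mulVec, hσd, Matrix.mul_assoc, hV, mul_one, ← mulVec_mulVec]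
      have : diagonal (fun j => (s j : ℂ)) *ᵥ Pi.single t.2 1 = 0 := by
        rw [mulVec_single_one]
        funext j
        by_cases hj : j = t.2
        · simp [hj, ← h0]
        · simp [diagonal_apply_ne _ hj]
      rw [this, mulVec_zero]
    have h2 := congrArg (Uᴴ *ᵥ ·) (hker _ h1)
    simp only [mulVec_zero] at h2
    have h3 : Uᴴ * (ρ * V) = diagonal (fun i => (r i : ℂ)) * Cᴴ := by
      nth_rw 1 [hρd]
      rw [hCh]
      simp only [← Matrix.mul_assoc]
      rw [hU, one_mul]
    rw [mulVec_mulVec, mulVec_mulVec, Matrix.mul_assoc, h3, mulVec_single_one] at h2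
    have h4 := congrFun h2 t.1
    rw [col_apply, diagonal_mul, conjTranspose_apply] at h4
    have h5 : C t.2 t.1 = 0 := by simpa [hr0] using h4
    rw [h5]; simp
  have hPle := hρ.expVal_le_one hψ
  have hE := proj_isHermitian ψ
  have hEE := proj_mul_self hψ
  have hbin : ∀ τ : Matrix n n ℂ, IsState τ → ∀ x y : ℝ,
      (τ * (x • proj ψ + y • (1 - proj ψ))).trace.re =
        x * expVal ψ τ + y * (1 - expVal ψ τ) := by
    intro τ hτ x y
    rw [expVal_eq_trace, trace_mul_comm (proj ψ) τ]
    simp only [mul_add, mul_sub, Matrix.mul_smul, trace_add, trace_smul, trace_sub, mul_one, hτ.2,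
      Complex.add_re, Complex.smul_re, Complex.sub_re, Complex.one_re, smul_eq_mul]
  have hlog := sum_mul_log_le hpos hsum (P := expVal ψ ρ) (by linarith) hPle (fun u hu => by
    obtain ⟨x, y, hxy⟩ := resolvent_bound hP hPle hq hu
    refine hxy.trans ?_
    have hX : (x • proj ψ + y • (1 - proj ψ)).IsHermitian := by
      rw [IsHermitian]
      simp only [conjTranspose_add, conjTranspose_smul, conjTranspose_sub, conjTranspose_one,
        hE.eq, star_trivial]
    have hXX : (x • proj ψ + y • (1 - proj ψ)) * (x • proj ψ + y • (1 - proj ψ)) =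
        (x ^ 2) • proj ψ + (y ^ 2) • (1 - proj ψ) := by
      have h1 : proj ψ * (1 - proj ψ) = 0 := by rw [mul_sub, mul_one, hEE, sub_self]
      have h2 : (1 - proj ψ) * proj ψ = 0 := by rw [sub_mul, one_mul, hEE, sub_self]
      have h3 : (1 - proj ψ) * (1 - proj ψ) = 1 - proj ψ := by
        rw [mul_sub, h2, mul_one, sub_zero]
      simp only [add_mul, mul_add, Matrix.smul_mul, Matrix.mul_smul, h1, h2, h3, hEE, smul_zero,
        add_zero, zero_add, smul_smul]
      simp only [sq]
    have := sum_resolvent_ge hr hs hρd hσd hU' hV' hX hu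
    rw [hXX, hbin ρ hρ, hbin σ hσ, hbin ρ hρ] at this
    exact this)
  rw [mul_sub, trace_sub, Complex.sub_re, hsame, hcross]
  simp only [gRE, Real.logb, ← mul_div_assoc]
  rw [← Finset.sum_div, ← Finset.sum_div, ← sub_div]
  have hl2 : 0 < Real.log 2 := Real.log_pos (by norm_num)
  rw [le_div_iff₀ hl2]
  field_simp
  linarith

end Bounds

/-! ### Functional calculus of GHZ-diagonal operators -/

section Diagonal

variable {N : ℕ} [NeZero N]

/-- The operators diagonal in the GHZ basis, as an algebra homomorphism. -/
def ghzDiagHom : (Index N → ℝ) →ₐ[ℝ] QOp N :=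
  AlgHom.ofLinearMap ⟨⟨ghzDiag, ghzDiag_add⟩, ghzDiag_smul⟩ ghzDiag_one
    fun p q => (ghzDiag_mul p q).symm

lemma cfc_ghzDiag (f : ℝ → ℝ) (p : Index N → ℝ) :
    cfc f (ghzDiag p) = ghzDiag fun b => f (p b) := by
  classical
  -- Interpolating `f` on the spectrum and on all values of `p` reduces to polynomials, which
  -- commute with the algebra homomorphism, without having to identify the spectrum with the values
  -- of `p`.
  set S : Finset ℝ := (ghzDiag p).finite_real_spectrum.toFinset ∪ Finset.univ.image p with hS
  have hinj : Set.InjOn (id : ℝ → ℝ) S := Function.injective_id.injOn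
  set Q := Lagrange.interpolate S id f with hQ
  have hnode : ∀ x ∈ S, Q.eval x = f x := fun x hx => Lagrange.eval_interpolate_at_node f hinj hx
  have h1 : cfc f (ghzDiag p) = cfc Q.eval (ghzDiag p) :=
    cfc_congr fun x hx => (hnode x (by simp [hS, hx])).symm
  rw [h1, cfc_polynomial Q _ (ghzDiag_isHermitian p).isSelfAdjoint]
  have h2 : Polynomial.aeval (ghzDiag p) Q = ghzDiag (Polynomial.aeval p Q) :=
    Polynomial.aeval_algHom_apply (ghzDiagHom (N := N)) p Q
  rw [h2]
  congr 1
  funext b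
  have h3 : Polynomial.aeval (p b) Q = (Polynomial.aeval p Q) b :=
    Polynomial.aeval_algHom_apply (Pi.evalAlgHom ℝ (fun _ : Index N => ℝ) b) p Q
  rw [← h3, Polynomial.coe_aeval_eq_eval]
  exact hnode _ (by simp [hS])

lemma re_trace_ghzDiag (p : Index N → ℝ) : (ghzDiag p).trace.re = ∑ b, p b := by
  rw [trace_ghzDiag, Complex.ofReal_re]

lemma trace_abs_ghzDiag_sub (p q : Index N → ℝ) :
    (cfc (fun x : ℝ => |x|) (ghzDiag p - ghzDiag q)).trace.re = ∑ b, |p b - q b| := by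
  rw [← ghzDiag_sub, cfc_ghzDiag, re_trace_ghzDiag]
  rfl

lemma affinity_ghzDiag (p q : Index N → ℝ) :
    (cfc Real.sqrt (ghzDiag p) * cfc Real.sqrt (ghzDiag q)).trace.re =
      ∑ b, Real.sqrt (p b) * Real.sqrt (q b) := by
  rw [cfc_ghzDiag, cfc_ghzDiag, ghzDiag_mul, re_trace_ghzDiag]
  rfl

lemma rootFidelity_ghzDiag {p q : Index N → ℝ} (hq : ∀ b, 0 ≤ q b) :
    rootFidelity (ghzDiag p) (ghzDiag q) = ∑ b, Real.sqrt (p b) * Real.sqrt (q b) := by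
  rw [rootFidelity, cfc_ghzDiag, ghzDiag_mul, ghzDiag_mul, cfc_ghzDiag, re_trace_ghzDiag]
  refine Finset.sum_congr rfl fun b _ => ?_
  simp only [Pi.mul_apply]
  rw [mul_right_comm, Real.mul_self_sqrt (hq b), mul_comm, Real.sqrt_mul' _ (hq b)]

lemma relativeEntropy_ghzDiag (p q : Index N → ℝ) :
    (ghzDiag p * (cfc (Real.logb 2) (ghzDiag p) - cfc (Real.logb 2) (ghzDiag q))).trace.re =
      ∑ b, p b * (Real.logb 2 (p b) - Real.logb 2 (q b)) := by
  rw [cfc_ghzDiag, cfc_ghzDiag, ← ghzDiag_sub, ghzDiag_mul, re_trace_ghzDiag]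
  rfl

/-- The operator with weights `p` factors through the one with weights `q`; the junk value of `p /
q` where `q` vanishes is harmless because `p` vanishes there too. -/
lemma ghzDiag_ker {p q : Index N → ℝ} (h : ∀ b, q b = 0 → p b = 0) (v : Bits N → ℂ)
    (hv : ghzDiag q *ᵥ v = 0) : ghzDiag p *ᵥ v = 0 := by
  have : p = (fun b => p b / q b) * q := by
    funext b
    by_cases hb : q b = 0
    · simp [hb, h b hb]
    · simp [div_mul_cancel₀ _ hb]
  rw [this, ← ghzDiag_mul, ← mulVec_mulVec, hv, mulVec_zero]

end Diagonal

/-! ### Sums over mixtures -/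

lemma sum_eq_of_mix {ι : Type*} [Fintype ι] {r h : ι → ℝ}
    (hr : r ∈ stdSimplex ℝ ι) {b₀ : ι} (hr0 : r b₀ = 0) {x y : ℝ} (h0 : h b₀ = x)
    (h1 : ∀ b, b ≠ b₀ → h b = y * r b) : ∑ b, h b = x + y := by
  classical
  have h2 : ∀ b, h b = (if b = b₀ then x else 0) + y * r b := fun b => by
    by_cases hb : b = b₀
    · rw [hb, h0, hr0, if_pos rfl]; ring
    · rw [h1 b hb, if_neg hb]; ring
  simp only [h2]
  rw [Finset.sum_add_distrib, ← Finset.mul_sum, hr.2]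
  simp

lemma sum_sqrt_mul_sqrt_mix {ι : Type*} [Fintype ι] [DecidableEq ι] {r : ι → ℝ}
    (hr : r ∈ stdSimplex ℝ ι) {b₀ : ι} (hr0 : r b₀ = 0) {P : ℝ} (hP1 : P ≤ 1) :
    ∑ b, Real.sqrt ((P • Pi.single b₀ 1 + (1 - P) • r : ι → ℝ) b) *
      Real.sqrt (((1 / 2 : ℝ) • Pi.single b₀ 1 + (1 - 1 / 2 : ℝ) • r : ι → ℝ) b) =
      Real.sqrt 2 / 2 * (Real.sqrt (1 - P) + Real.sqrt P) := by
  have hhalf : Real.sqrt (1 / 2) = Real.sqrt 2 / 2 := by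
    rw [Real.sqrt_div zero_le_one, Real.sqrt_one, Real.sqrt_div_self']
  rw [sum_eq_of_mix hr hr0 (x := Real.sqrt P * (Real.sqrt 2 / 2))
    (y := Real.sqrt (1 - P) * (Real.sqrt 2 / 2))]
  · ring
  · simp only [Pi.add_apply, Pi.smul_apply, Pi.single_eq_same, hr0, smul_eq_mul, mul_one, mul_zero,
      add_zero, hhalf]
  · intro b hb
    simp only [Pi.add_apply, Pi.smul_apply, Pi.single_eq_of_ne hb, smul_eq_mul, mul_zero, zero_add]
    rw [Real.sqrt_mul (by linarith), show (1 - 1 / 2 : ℝ) = 1 / 2 by norm_num,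
      Real.sqrt_mul (by norm_num), hhalf]
    linear_combination Real.sqrt (1 - P) * (Real.sqrt 2 / 2) * Real.mul_self_sqrt (hr.1 b)

lemma sum_sqrt_mul_self {ι : Type*} [Fintype ι] {p : ι → ℝ} (hp : p ∈ stdSimplex ℝ ι) :
    ∑ b, Real.sqrt (p b) * Real.sqrt (p b) = 1 := by
  rw [← hp.2]
  exact Finset.sum_congr rfl fun b _ => Real.mul_self_sqrt (hp.1 b)

/-! ### The explicit functions -/

lemma gRE_eq (p : ℝ) : gRE p = 1 - Real.binEntropy p / Real.log 2 := by
  rw [gRE, Real.binEntropy_eq_negMulLog_add_negMulLog_one_sub, Real.negMulLog, Real.negMulLog,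
    Real.logb, Real.logb]
  ring

lemma strictMonoOn_gRE : StrictMonoOn gRE (Set.Icc (1 / 2) 1) := by
  intro p hp p' hp' h
  rw [one_div] at hp hp'
  rw [gRE_eq, gRE_eq]
  have := Real.binEntropy_strictAntiOn hp hp' h
  have hl2 : 0 < Real.log 2 := Real.log_pos (by norm_num)
  have := div_lt_div_of_pos_right this hl2
  linarith

lemma strictMonoOn_gTr : StrictMonoOn gTr (Set.Icc (1 / 2) 1) := fun p _ p' _ h => by
  rw [gTr, gTr]; linarith

lemma strictMonoOn_gF : StrictMonoOn gF (Set.Icc (1 / 2) 1) := by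
  intro p hp p' hp' h
  rw [gF, gF]
  have : Real.sqrt (p' * (1 - p')) < Real.sqrt (p * (1 - p)) := by
    refine Real.sqrt_lt_sqrt (mul_nonneg (by linarith [hp'.1]) (by linarith [hp'.2])) ?_
    nlinarith [hp.1]
  linarith

lemma sqrt_add_sqrt_sq {p : ℝ} (h0 : 0 ≤ p) (h1 : p ≤ 1) :
    (Real.sqrt (1 - p) + Real.sqrt p) ^ 2 = 1 + 2 * Real.sqrt (p * (1 - p)) := by
  rw [Real.sqrt_mul h0, add_sq, Real.sq_sqrt h0, Real.sq_sqrt (by linarith)]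
  ring

lemma strictMonoOn_gB : StrictMonoOn gB (Set.Icc (1 / 2) 1) := by
  intro p hp p' hp' h
  have h1 := strictMonoOn_gF hp hp' h
  rw [gF, gF] at h1
  -- The squares of both sides involve only `√(p (1 - p))`, whose monotonicity is that of `gF`.
  have h2 : Real.sqrt (1 - p') + Real.sqrt p' < Real.sqrt (1 - p) + Real.sqrt p := by
    refine lt_of_pow_lt_pow_left₀ 2 (by positivity) ?_
    rw [sqrt_add_sqrt_sq (by linarith [hp.1]) hp.2, sqrt_add_sqrt_sq (by linarith [hp'.1]) hp'.2]
    linarith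
  rw [gB, gB]
  have := mul_lt_mul_of_pos_left h2 (Real.sqrt_pos.2 (by norm_num : (0 : ℝ) < 2))
  linarith

lemma gRE_half : gRE (1 / 2) = 0 := by
  rw [gRE_eq, one_div, Real.binEntropy_two_inv, div_self (Real.log_pos (by norm_num)).ne', sub_self]

lemma gTr_half : gTr (1 / 2) = 0 := by rw [gTr, sub_self]

lemma gF_half : gF (1 / 2) = 0 := by
  rw [gF, show (1 / 2 : ℝ) * (1 - 1 / 2) = (1 / 2) ^ 2 by norm_num,
    Real.sqrt_sq (by norm_num), sub_self]

lemma gB_half : gB (1 / 2) = 0 := by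
  rw [gB, show (1 - 1 / 2 : ℝ) = 1 / 2 by norm_num, ← two_mul, mul_left_comm,
    ← Real.sqrt_mul (by norm_num)]
  norm_num

/-! ### The laws of the standard distances -/

section Laws

variable {N : ℕ}

lemma genuineLaw_of_real_bound (hN : 2 ≤ N) {D : QOp N → QOp N → ℝ≥0∞} {g : ℝ → ℝ}
    (hg : StrictMonoOn g (Set.Icc (1 / 2) 1)) (hg0 : g (1 / 2) = 0)
    (hself : ∀ p ∈ stdSimplex ℝ (Index N), D (ghzDiag p) (ghzDiag p) = 0)
    (hlow : ∀ ψ, star ψ ⬝ᵥ ψ = 1 → ∀ ρ σ, IsState ρ → IsState σ → 1 / 2 < expVal ψ ρ →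
      expVal ψ σ ≤ 1 / 2 → ENNReal.ofReal (g (expVal ψ ρ)) ≤ D ρ σ)
    (hattain : ∀ (b₀ : Index N), ∀ r ∈ stdSimplex ℝ (Index N), r b₀ = 0 → ∀ P : ℝ, 1 / 2 < P →
      P ≤ 1 → D (ghzDiag (P • Pi.single b₀ 1 + (1 - P) • r))
        (ghzDiag ((1 / 2 : ℝ) • Pi.single b₀ 1 + (1 - 1 / 2 : ℝ) • r)) = ENNReal.ofReal (g P)) :
    GenuineLaw N D fun p => ENNReal.ofReal (g p) := by
  refine genuineLaw_of_bound hN hself hlow hattain (fun p hp p' hp' h => ?_)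
    fun _ p p' h1 h2 h3 _ => ?_
  · exact ENNReal.ofReal_le_ofReal
      (hg.monotoneOn (Set.Ioc_subset_Icc_self hp) (Set.Ioc_subset_Icc_self hp') h)
  · have hp' : p' ∈ Set.Icc (1 / 2 : ℝ) 1 := ⟨by linarith, h3⟩
    -- `ENNReal.ofReal` is strict only above 0, which is why the value of `g` at 1/2 is needed.
    have hpos : 0 < g p' := by
      rw [← hg0]
      exact hg (by norm_num) hp' (by linarith)
    exact (ENNReal.ofReal_lt_ofReal_iff hpos).2 (hg ⟨h1.le, by linarith⟩ hp' h2)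

lemma genuineLaw_dRE (hN : 2 ≤ N) : GenuineLaw N dRE fun p => ENNReal.ofReal (gRE p) := by
  have : NeZero N := ⟨by omega⟩
  refine genuineLaw_of_real_bound hN strictMonoOn_gRE gRE_half (fun p _ => ?_)
    (fun ψ hψ ρ σ hρ hσ hP hq => ?_) fun b₀ r hr hr0 P hP hP1 => ?_
  · rw [dRE, if_pos fun v hv => hv]
    simp
  · rw [dRE]
    split_ifs with hker
    · exact ENNReal.ofReal_le_ofReal (gRE_le_relativeEntropy hψ hρ hσ hP hq hker)
    · exact le_top
  · rw [dRE, if_pos, relativeEntropy_ghzDiag]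
    · congr 1
      rw [sum_eq_of_mix hr hr0 (x := P * (Real.logb 2 P + 1))
        (y := (1 - P) * (Real.logb 2 (1 - P) + 1)), gRE]
      · ring
      · simp only [Pi.add_apply, Pi.smul_apply, Pi.single_eq_same, hr0, smul_eq_mul, mul_one,
          mul_zero, add_zero, one_div, Real.logb_inv]
        rw [Real.logb_self_eq_one (by norm_num)]
        ring
      · intro b hb
        simp only [Pi.add_apply, Pi.smul_apply, Pi.single_eq_of_ne hb, smul_eq_mul, mul_zero,
          zero_add]
        -- Off `b₀` the terms `log (r b)` cancel between the two states. Zero weights are split off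
        -- because the logarithm of a product is additive only for nonzero factors.
        by_cases h1 : r b = 0
        · simp [h1]
        by_cases h2 : 1 - P = 0
        · simp [h2]
        rw [Real.logb_mul h2 h1, Real.logb_mul (by norm_num) h1,
          show (1 - 1 / 2 : ℝ) = 2⁻¹ by norm_num, Real.logb_inv, Real.logb_self_eq_one (by norm_num)]
        ring
    · refine ghzDiag_ker fun b hb => ?_
      by_cases h : b = b₀
      · subst h
        simp [hr0] at hb
      · simp only [Pi.add_apply, Pi.smul_apply, Pi.single_eq_of_ne h, smul_eq_mul, mul_zero,
          zero_add] at hb ⊢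
        rw [(mul_eq_zero.1 hb).resolve_left (by norm_num), mul_zero]

lemma genuineLaw_dTr (hN : 2 ≤ N) : GenuineLaw N dTr fun p => ENNReal.ofReal (gTr p) := by
  have : NeZero N := ⟨by omega⟩
  refine genuineLaw_of_real_bound hN strictMonoOn_gTr gTr_half (fun p _ => ?_)
    (fun ψ hψ ρ σ hρ hσ hP hq => ?_) fun b₀ r hr hr0 P hP hP1 => ?_
  · rw [dTr, trace_abs_ghzDiag_sub]; simp
  · refine ENNReal.ofReal_le_ofReal (le_trans ?_ (expVal_sub_le_trace_abs hψ hρ hσ))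
    rw [gTr]; linarith
  · rw [dTr, trace_abs_ghzDiag_sub, sum_eq_of_mix hr hr0 (x := P - 1 / 2) (y := P - 1 / 2), gTr]
    · congr 1; ring
    · simp only [Pi.add_apply, Pi.smul_apply, Pi.single_eq_same, hr0, smul_eq_mul, mul_one,
        mul_zero, add_zero]
      exact abs_of_pos (by linarith)
    · intro b hb
      simp only [Pi.add_apply, Pi.smul_apply, Pi.single_eq_of_ne hb, smul_eq_mul, mul_zero,
        zero_add]
      rw [← sub_mul, abs_mul, abs_of_nonneg (hr.1 b), abs_of_neg (by linarith)]
      ring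

lemma sqrt_two_div_two_sq (x : ℝ) : (Real.sqrt 2 / 2 * x) ^ 2 = x ^ 2 / 2 := by
  rw [mul_pow, div_pow, Real.sq_sqrt (by norm_num)]; ring

lemma genuineLaw_dF (hN : 2 ≤ N) : GenuineLaw N dF fun p => ENNReal.ofReal (gF p) := by
  have : NeZero N := ⟨by omega⟩
  refine genuineLaw_of_real_bound hN strictMonoOn_gF gF_half (fun p hp => ?_)
    (fun ψ hψ ρ σ hρ hσ hP hq => ?_) fun b₀ r hr hr0 P hP hP1 => ?_
  · rw [dF, rootFidelity_ghzDiag hp.1, sum_sqrt_mul_self hp]; simp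
  · refine ENNReal.ofReal_le_ofReal ?_
    have h1 := pow_le_pow_left₀ (rootFidelity_nonneg ρ σ) (rootFidelity_le hψ hρ hσ hP.le hq) 2
    rw [sqrt_two_div_two_sq, sqrt_add_sqrt_sq (by linarith) (hρ.expVal_le_one hψ)] at h1
    rw [gF]
    linarith
  · rw [dF, rootFidelity_ghzDiag
      (mix_mem_stdSimplex b₀ hr (P := 1 / 2) (by norm_num) (by norm_num)).1,
      sum_sqrt_mul_sqrt_mix hr hr0 hP1, sqrt_two_div_two_sq,
      sqrt_add_sqrt_sq (by linarith) hP1, gF]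
    congr 1
    ring

lemma genuineLaw_dB (hN : 2 ≤ N) : GenuineLaw N dB fun p => ENNReal.ofReal (gB p) := by
  have : NeZero N := ⟨by omega⟩
  refine genuineLaw_of_real_bound hN strictMonoOn_gB gB_half (fun p hp => ?_)
    (fun ψ hψ ρ σ hρ hσ hP hq => ?_) fun b₀ r hr hr0 P hP hP1 => ?_
  · rw [dB, rootFidelity_ghzDiag hp.1, sum_sqrt_mul_self hp]; simp
  · refine ENNReal.ofReal_le_ofReal ?_
    have h1 := rootFidelity_le hψ hρ hσ hP.le hq
    rw [gB]
    linarith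
  · rw [dB, rootFidelity_ghzDiag
      (mix_mem_stdSimplex b₀ hr (P := 1 / 2) (by norm_num) (by norm_num)).1,
      sum_sqrt_mul_sqrt_mix hr hr0 hP1, gB]
    congr 1
    ring

lemma genuineLaw_dH (hN : 2 ≤ N) : GenuineLaw N dH fun p => ENNReal.ofReal (gB p) := by
  have : NeZero N := ⟨by omega⟩
  refine genuineLaw_of_real_bound hN strictMonoOn_gB gB_half (fun p hp => ?_)
    (fun ψ hψ ρ σ hρ hσ hP hq => ?_) fun b₀ r hr hr0 P hP hP1 => ?_
  · rw [dH, affinity_ghzDiag, sum_sqrt_mul_self hp]; simp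
  · refine ENNReal.ofReal_le_ofReal ?_
    have h1 := affinity_le hψ hρ hσ hP.le hq
    rw [gB]
    linarith
  · rw [dH, affinity_ghzDiag, sum_sqrt_mul_sqrt_mix hr hr0 hP1, gB]
    congr 1
    ring

end Laws

end GHZ

end

theorem mainTheorem8 :
    -- GHZ-diagonal states are biseparable exactly when the largest eigenvalue is at most 1/2
    (∀ N : ℕ, 2 ≤ N → ∀ p ∈ stdSimplex ℝ (GHZ.Index N), ∀ b₀, (∀ b, p b ≤ p b₀) →
      (GHZ.ghzDiag p ∈ GHZ.mSeparable N 2 ↔ p b₀ ≤ 1 / 2)) ∧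
    -- GHZ-diagonalisation is a fixed mixture of local unitaries
    (∀ N : ℕ, 2 ≤ N → ∃ (K : ℕ) (w : Fin K → ℝ) (U : Fin K → Fin N → Matrix (Fin 2) (Fin 2) ℂ),
      w ∈ stdSimplex ℝ (Fin K) ∧ (∀ j k, U j k ∈ Matrix.unitaryGroup (Fin 2) ℂ) ∧
      ∀ ρ : GHZ.QOp N, GHZ.IsState ρ →
        GHZ.overlap ρ ∈ stdSimplex ℝ (GHZ.Index N) ∧
        ∑ j, w j • GHZ.localConj (U j) ρ = GHZ.ghzDiag (GHZ.overlap ρ)) ∧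
    -- every contractive convex distance on N-qubit states
    (∀ N : ℕ, 2 ≤ N → ∀ D : GHZ.QOp N → GHZ.QOp N → ENNReal, GHZ.IsContractiveConvex D →
      ∃ g : ℝ → ENNReal, GHZ.GenuineLaw N D g) ∧
    -- the function g does not depend on N for a distance that is given for all N
    (∀ D : (N : ℕ) → GHZ.QOp N → GHZ.QOp N → ENNReal, GHZ.IsContractiveConvexFamily D →
      ∃ g : ℝ → ENNReal, ∀ N : ℕ, 2 ≤ N → GHZ.GenuineLaw N (D N) g) ∧
    -- the standard distances
    (∀ N : ℕ, 2 ≤ N →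
      GHZ.GenuineLaw N GHZ.dRE (fun p => ENNReal.ofReal (GHZ.gRE p)) ∧
      GHZ.GenuineLaw N GHZ.dTr (fun p => ENNReal.ofReal (GHZ.gTr p)) ∧
      GHZ.GenuineLaw N GHZ.dF (fun p => ENNReal.ofReal (GHZ.gF p)) ∧
      GHZ.GenuineLaw N GHZ.dB (fun p => ENNReal.ofReal (GHZ.gB p)) ∧
      GHZ.GenuineLaw N GHZ.dH (fun p => ENNReal.ofReal (GHZ.gB p))) ∧
    (StrictMonoOn GHZ.gRE (Set.Icc (1 / 2) 1) ∧ StrictMonoOn GHZ.gTr (Set.Icc (1 / 2) 1) ∧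
      StrictMonoOn GHZ.gF (Set.Icc (1 / 2) 1) ∧ StrictMonoOn GHZ.gB (Set.Icc (1 / 2) 1)) :=
  ⟨fun _ hN _ hp _ hb => GHZ.ghzDiag_mem_mSeparable_iff hN hp hb,
    fun _ hN => GHZ.exists_ghzDiagonalisation hN,
    fun _ hN _ hD => GHZ.exists_genuineLaw hN hD,
    fun _ hD => GHZ.exists_genuineLaw_family hD,
    fun _ hN => ⟨GHZ.genuineLaw_dRE hN, GHZ.genuineLaw_dTr hN, GHZ.genuineLaw_dF hN,
      GHZ.genuineLaw_dB hN, GHZ.genuineLaw_dH hN⟩,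
    GHZ.strictMonoOn_gRE, GHZ.strictMonoOn_gTr, GHZ.strictMonoOn_gF, GHZ.strictMonoOn_gB⟩
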